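/- Let the discrepancy of a finite multiset $\Xi=\{\xi_1,\ldots,\xi_N\}$ of points of $[0,1)$ be $$ D(\Xi)=\sup_{0\le\alpha<\beta\le 1}\bigl|\#\{1\le n\le N:\ \xi_n\in[\alpha,\beta)\}-(\beta-\alpha)N\bigr| . $$ For a prime $q$ and positive integers $P,R$, let $\Delta_q(P,R)$ be the discrepancy of the multiset of points $x/q$, taken once for every triple $(p,r,x)$ with $p\le P$ and $r\le R$ prime, $x\in\{0,\ldots,q-1\}$ and $x^2\equiv pr\pmod q$. There is a function $\eta:\mathbb{N}\to\mathbb{R}$ with $\eta(V)\to0$ as $V\to\infty$ such that, for every prime $q$ and all integers $P,R$ with $1\le P,R\le q$, $$ \Delta_q(P,R)\le q^{1/8}(PR)^{19/24+\eta(PR)}\left(\frac{P^{7/48}}{q^{1/16}}+1\right)\left(\frac{R^{7/48}}{q^{1/16}}+1\right). $$ -/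

import Mathlib

open Filter Topology

/-- The (unnormalised) discrepancy of a finite multiset `Ξ` of points of `[0, 1)`:
the supremum over `0 ≤ α < β ≤ 1` of `|#{ξ ∈ Ξ : α ≤ ξ < β} - (β - α) #Ξ|`, where points are
counted with multiplicity. The set of values is nonempty and bounded by `#Ξ`, so that `sSup` is
the true supremum. -/
noncomputable def discrepancy (Ξ : Multiset ℝ) : ℝ :=
  sSup {d : ℝ | ∃ α β : ℝ, 0 ≤ α ∧ α < β ∧ β ≤ 1 ∧
    d = |(Multiset.countP (fun ξ => α ≤ ξ ∧ ξ < β) Ξ : ℝ) - (β - α) * (Multiset.card Ξ : ℝ)|}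

/-- The triples `(p, r, x)` with `p ≤ P` and `r ≤ R` prime, `x ∈ {0, …, q - 1}` and
`x² ≡ p r (mod q)`. -/
def primeProductRoots (q P R : ℕ) : Finset (ℕ × ℕ × ℕ) :=
  (Finset.range (P + 1) ×ˢ Finset.range (R + 1) ×ˢ Finset.range q).filter fun t =>
    t.1.Prime ∧ t.2.1.Prime ∧ t.2.2 ^ 2 ≡ t.1 * t.2.1 [MOD q]

/-- The multiset of points `x / q`, one for each triple `(p, r, x)` as above. -/
noncomputable def primeProductRootPoints (q P R : ℕ) : Multiset ℝ :=
  (primeProductRoots q P R).val.map fun t => (t.2.2 : ℝ) / (q : ℝ)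

/-- The discrepancy `Δ_q(P, R)` of the modular square roots of products of two primes. -/
noncomputable def rootDiscrepancy (q P R : ℕ) : ℝ :=
  discrepancy (primeProductRootPoints q P R)

/-! Completion reduces the discrepancy to bounding `S(h) = ∑ e(h x / q)` over the roots `x`, for `h
≠ 0`. Every root of `p r` is a product `u v` with either `u² = p`, `v² = r`, or `u² = g p`, `v² =
g⁻¹ r` for a fixed nonresidue `g`. Counting these gives `2 S` as a sum of two genuinely bilinear
sums (`two_mul_sum_primeProductRoots`). Repeated Cauchy–Schwarz and Parseval bound the eighth power
of such a sum by `|U|⁴ |V|⁴ q E(U) E(V)`, with `E` the additive energy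
(`norm_bilinear_sum_pow_eight_le`).

The core is `addEnergy_modular_sqrt_le`: for roots of `c m`, `m ≤ M`, the energy is at most
`M^(2+o(1)) (√(M³/q) + M^(1/3))`. Let `r(l)` count `u + v = l ≠ 0`, and put `d = m_u - m_v`, `y = 2
(m_u + m_v)`. Then `c² d² + l⁴ = c l² y`, so two solutions give a point `(d² - d'², y - y')` of the
lattice `(c / l²) X ≡ Y`. By the divisor bound `r(l)²` is, up to `M^o(1)`, at most the number of
lattice points in an `M² × 4M` box, that is `M³/q + M³/N + 1`, with `N` the weighted length of a
shortest vector `(a, b)`. If `N` is not small, `r(l)` is bounded pointwise and `∑ r(l) ≤ 4M²`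
finishes. If it is small, then `r(l)²` is essentially at most `M²/a` and `|b| ≤ 4 M^(1/3)`; since
`(a, b)` determines `l²`, summing `1/a` over a box costs only `M^(1/3) log M`.

Logarithms of `q` are harmless: if `PR ≤ q^(3/5)` the trivial bound suffices, and otherwise `log q`
is at most a multiple of `log PR`. -/

/-! ### Divisor bound and harmonic sums -/

/-- The divisor bound: `τ(n) ≤ C n ^ ε`. -/
theorem exists_card_divisors_le_rpow {ε : ℝ} (hε : 0 < ε) :
    ∃ C : ℝ, 1 ≤ C ∧ ∀ n : ℕ, n ≠ 0 → (n.divisors.card : ℝ) ≤ C * (n : ℝ) ^ ε := by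
  -- Chosen so that `v + 1 ≤ K (1 + v ε log 2)`; by Bernoulli the bracket is at most `2^(ε v)`.
  set K : ℝ := 1 + 1 / (ε * Real.log 2) with hK
  have hlog : 0 < Real.log 2 := Real.log_pos one_lt_two
  have hK1 : 1 ≤ K := by
    have : 0 ≤ 1 / (ε * Real.log 2) := by positivity
    linarith
  -- Primes `p ≥ B` have `p^ε ≥ 2`, so `v + 1 ≤ 2^v ≤ p^(ε v)` without loss; only the fewer than `B`
  -- smaller primes cost a factor `K`.
  obtain ⟨B, hB⟩ := exists_nat_ge ((2 : ℝ) ^ (1 / ε))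
  refine ⟨K ^ B, one_le_pow₀ hK1, fun n hn => ?_⟩
  have hterm : ∀ p ∈ n.primeFactors, ((n.factorization p + 1 : ℕ) : ℝ) ≤
      (if p < B then K else 1) * ((p : ℝ) ^ n.factorization p) ^ ε := by
    intro p hp
    have hp2 : (2 : ℝ) ≤ p := by exact_mod_cast (Nat.prime_of_mem_primeFactors hp).two_le
    set v := n.factorization p
    have hexp : ∀ x : ℝ, 0 ≤ x → 1 + v * Real.log 2 * x ≤ ((2 : ℝ) ^ x) ^ v := by
      intro x hx
      have h1 : 1 + x * Real.log 2 ≤ (2 : ℝ) ^ x := by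
        rw [Real.rpow_def_of_pos two_pos, mul_comm]
        linarith [Real.add_one_le_exp (Real.log 2 * x)]
      have h2 := one_add_mul_le_pow (a := x * Real.log 2)
        (by have : 0 ≤ x * Real.log 2 := by positivity
            linarith) v
      calc 1 + v * Real.log 2 * x = 1 + (v : ℝ) * (x * Real.log 2) := by ring
        _ ≤ _ := h2
        _ ≤ _ := by gcongr
    have hcomm : ((p : ℝ) ^ v) ^ ε = ((p : ℝ) ^ ε) ^ v := by
      rw [← Real.rpow_natCast, ← Real.rpow_natCast, ← Real.rpow_mul (by positivity),
        ← Real.rpow_mul (by positivity), mul_comm]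
    rw [hcomm]
    push_cast
    split_ifs with hpB
    · have h1 := hexp ε hε.le
      have h2 : ((2 : ℝ) ^ ε) ^ v ≤ ((p : ℝ) ^ ε) ^ v := by gcongr
      have h3 : 0 ≤ (v : ℝ) * Real.log 2 * ε := by positivity
      have h4 : (v : ℝ) + 1 ≤ K * (1 + v * Real.log 2 * ε) := by
        have : 1 / (ε * Real.log 2) * (v * Real.log 2 * ε) = v := by field_simp
        have h5 : 0 ≤ 1 / (ε * Real.log 2) := by positivity
        rw [hK]; nlinarith
      exact h4.trans (mul_le_mul_of_nonneg_left (h1.trans h2) (by linarith))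
    · have hge : (2 : ℝ) ≤ (p : ℝ) ^ ε := by
        have : (2 : ℝ) ^ (1 / ε) ≤ p := hB.trans (by exact_mod_cast not_lt.1 hpB)
        calc (2 : ℝ) = ((2 : ℝ) ^ (1 / ε)) ^ ε := by
              rw [← Real.rpow_mul two_pos.le]; simp [hε.ne']
          _ ≤ _ := by gcongr
      have h1 : ((v + 1 : ℕ) : ℝ) ≤ (2 : ℝ) ^ v := by exact_mod_cast Nat.lt_two_pow_self
      push_cast at h1
      calc (v : ℝ) + 1 ≤ 2 ^ v := h1
        _ ≤ ((p : ℝ) ^ ε) ^ v := by gcongr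
        _ = _ := (one_mul _).symm
  have hn' : (n : ℝ) ^ ε = ∏ p ∈ n.primeFactors, ((p : ℝ) ^ n.factorization p) ^ ε := by
    rw [Real.finsetProd_rpow _ _ (fun p _ => by positivity)]
    congr 1
    conv_lhs => rw [← Nat.prod_factorization_pow_eq_self hn]
    rw [Finsupp.prod, Nat.support_factorization]
    push_cast
    rfl
  rw [Nat.card_divisors hn]
  push_cast
  calc ∏ p ∈ n.primeFactors, ((n.factorization p : ℝ) + 1)
      ≤ ∏ p ∈ n.primeFactors, (if p < B then K else 1) * ((p : ℝ) ^ n.factorization p) ^ ε := by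
        refine Finset.prod_le_prod (fun p _ => by positivity) fun p hp => ?_
        exact_mod_cast hterm p hp
    _ = (∏ p ∈ n.primeFactors, if p < B then K else 1) * (n : ℝ) ^ ε := by
        rw [Finset.prod_mul_distrib, hn']
    _ ≤ K ^ B * (n : ℝ) ^ ε := by
        gcongr
        rw [← Finset.prod_filter, Finset.prod_const]
        refine pow_le_pow_right₀ hK1 ?_
        calc _ ≤ (Finset.range B).card := Finset.card_le_card fun p hp => by
              simpa using (Finset.mem_filter.1 hp).2
          _ = B := Finset.card_range B

theorem sum_Icc_inv_le (A : ℕ) : ∑ k ∈ Finset.Icc 1 A, (k : ℝ)⁻¹ ≤ 1 + Real.log A := by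
  have h1 := harmonic_le_one_add_log A
  rw [harmonic_eq_sum_Icc] at h1
  push_cast at h1
  exact h1

/-! ### Exponential sums, additive energy and completion -/

section AdditiveCharacters

variable {q : ℕ} [Fact q.Prime]

local notation "ψ" => ZMod.stdAddChar (N := q)

theorem norm_stdAddChar_eq_one (x : ZMod q) : ‖ψ x‖ = 1 := by
  rw [ZMod.stdAddChar_apply]; exact Circle.norm_coe _

theorem sum_stdAddChar_mul (x : ZMod q) :
    ∑ ξ : ZMod q, ψ (ξ * x) = if x = 0 then (q : ℂ) else 0 := by
  rw [AddChar.sum_mulShift x (ZMod.isPrimitive_stdAddChar q)]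
  simp [ZMod.card]

theorem normSq_sum_stdAddChar {ι : Type*} (s : Finset ι) (g : ι → ZMod q) (ξ : ZMod q) :
    ((‖∑ i ∈ s, ψ (ξ * g i)‖ ^ 2 : ℝ) : ℂ) =
      ∑ z ∈ s ×ˢ s, ψ (ξ * (g z.1 - g z.2)) := by
  push_cast
  rw [← Complex.mul_conj', map_sum, Finset.sum_mul_sum, Finset.sum_product]
  refine Finset.sum_congr rfl fun i _ => Finset.sum_congr rfl fun j _ => ?_
  rw [← AddChar.map_neg_eq_conj, ← AddChar.map_add_eq_mul]
  congr 1; ring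

/-- Parseval's identity for the exponential sum over a finite family of residues. -/
theorem sum_normSq_sum_stdAddChar {ι : Type*} (s : Finset ι) (g : ι → ZMod q) :
    ∑ ξ : ZMod q, ‖∑ i ∈ s, ψ (ξ * g i)‖ ^ 2 =
      q * ∑ l : ZMod q, ((s.filter fun i => g i = l).card : ℝ) ^ 2 := by
  have h1 : ((∑ ξ : ZMod q, ‖∑ i ∈ s, ψ (ξ * g i)‖ ^ 2 : ℝ) : ℂ) =
      ∑ z ∈ s ×ˢ s, if g z.1 = g z.2 then (q : ℂ) else 0 := by
    rw [Complex.ofReal_sum]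
    simp_rw [normSq_sum_stdAddChar]
    rw [Finset.sum_comm]
    refine Finset.sum_congr rfl fun z _ => ?_
    rw [sum_stdAddChar_mul]; simp only [sub_eq_zero]
  have h2 : ∑ l : ZMod q, ((s.filter fun i => g i = l).card : ℝ) ^ 2 =
      ∑ z ∈ s ×ˢ s, if g z.1 = g z.2 then (1 : ℝ) else 0 := by
    simp_rw [Finset.card_filter, sq]
    push_cast
    simp_rw [Finset.sum_mul_sum]
    rw [Finset.sum_comm, Finset.sum_product]
    refine Finset.sum_congr rfl fun i _ => ?_
    rw [Finset.sum_comm]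
    refine Finset.sum_congr rfl fun j _ => ?_
    simp [eq_comm]
  rw [h2]
  apply Complex.ofReal_injective
  rw [h1]
  push_cast
  rw [Finset.mul_sum]
  refine Finset.sum_congr rfl fun z _ => ?_
  split_ifs <;> simp

/-- The square of the sum is the exponential sum of the family `u + u'`, to which Parseval applies.
-/
theorem sum_norm_pow_four_eq_addEnergy (U : Finset (ZMod q)) :
    ∑ ξ : ZMod q, ‖∑ u ∈ U, ψ (ξ * u)‖ ^ 4 = q * (Finset.addEnergy U U : ℝ) := by
  rw [Finset.addEnergy_eq_sum_sq]
  have := sum_normSq_sum_stdAddChar (U ×ˢ U) fun z => z.1 + z.2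
  push_cast
  rw [← this]
  refine Finset.sum_congr rfl fun ξ _ => ?_
  have h : ∑ z ∈ U ×ˢ U, ψ (ξ * (z.1 + z.2)) = (∑ u ∈ U, ψ (ξ * u)) ^ 2 := by
    rw [sq, Finset.sum_mul_sum, Finset.sum_product]
    refine Finset.sum_congr rfl fun i _ => Finset.sum_congr rfl fun j _ => ?_
    rw [mul_add, AddChar.map_add_eq_mul]
  rw [h, norm_pow]; ring

/-- Squared modulus is the exponential sum of the differences, so Parseval for differences gives the
same fourth moment as for sums. -/
theorem sum_sq_card_sub_eq_addEnergy (U : Finset (ZMod q)) :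
    ∑ l : ZMod q, (((U ×ˢ U).filter fun z => z.1 - z.2 = l).card : ℝ) ^ 2 =
      (Finset.addEnergy U U : ℝ) := by
  have hq : (q : ℝ) ≠ 0 := by exact_mod_cast (Fact.out : q.Prime).ne_zero
  apply mul_left_cancel₀ hq
  rw [← sum_normSq_sum_stdAddChar, ← sum_norm_pow_four_eq_addEnergy]
  refine Finset.sum_congr rfl fun ξ _ => ?_
  rw [← normSq_sum_stdAddChar U (fun u => u) ξ, Complex.norm_real, Real.norm_eq_abs,
    abs_of_nonneg (by positivity)]
  ring

/-- A bilinear exponential sum is controlled by additive energies. -/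
theorem norm_bilinear_sum_pow_eight_le (U V : Finset (ZMod q)) {h : ZMod q} (hh : h ≠ 0) :
    ‖∑ u ∈ U, ∑ v ∈ V, ψ (h * (u * v))‖ ^ 8 ≤
      (U.card : ℝ) ^ 4 * (V.card : ℝ) ^ 4 *
        (q * (Finset.addEnergy U U : ℝ) * (Finset.addEnergy V V : ℝ)) := by
  set S := ∑ u ∈ U, ∑ v ∈ V, ψ (h * (u * v)) with hS
  set A : ZMod q → ℂ := fun ξ => ∑ u ∈ U, ψ (ξ * u) with hA
  set w : ZMod q → ℝ := fun l => ((V ×ˢ V).filter fun z => z.1 - z.2 = l).card with hw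
  have s1 : ‖S‖ ^ 2 ≤ U.card * ∑ u ∈ U, ‖∑ v ∈ V, ψ (h * u * v)‖ ^ 2 := by
    calc ‖S‖ ^ 2 ≤ (∑ u ∈ U, ‖∑ v ∈ V, ψ (h * u * v)‖) ^ 2 := by
          simp only [hS, ← mul_assoc]
          gcongr
          exact norm_sum_le _ _
      _ ≤ _ := sq_sum_le_card_mul_sum_sq
  -- Opening the square and summing over `u` first leaves a sum over `U` at the frequency `h (v -
  -- v')`.
  have s2 : ∑ u ∈ U, ‖∑ v ∈ V, ψ (h * u * v)‖ ^ 2 ≤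
      ∑ z ∈ V ×ˢ V, ‖A (h * (z.1 - z.2))‖ := by
    have : ((∑ u ∈ U, ‖∑ v ∈ V, ψ (h * u * v)‖ ^ 2 : ℝ) : ℂ) =
        ∑ z ∈ V ×ˢ V, A (h * (z.1 - z.2)) := by
      rw [Complex.ofReal_sum]
      simp_rw [normSq_sum_stdAddChar]
      rw [Finset.sum_comm]
      refine Finset.sum_congr rfl fun z _ => Finset.sum_congr rfl fun u _ => ?_
      congr 1; ring
    calc _ = ‖((∑ u ∈ U, ‖∑ v ∈ V, ψ (h * u * v)‖ ^ 2 : ℝ) : ℂ)‖ := by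
          rw [Complex.norm_real, Real.norm_eq_abs, abs_of_nonneg (by positivity)]
      _ ≤ _ := by rw [this]; exact norm_sum_le _ _
  have s3 : (∑ z ∈ V ×ˢ V, ‖A (h * (z.1 - z.2))‖) ^ 2 ≤
      (V.card : ℝ) ^ 2 * ∑ l : ZMod q, w l * ‖A (h * l)‖ ^ 2 := by
    have h1 := sq_sum_le_card_mul_sum_sq (s := V ×ˢ V)
      (f := fun z => ‖A (h * (z.1 - z.2))‖)
    have h2 : ∑ z ∈ V ×ˢ V, ‖A (h * (z.1 - z.2))‖ ^ 2 =
        ∑ l : ZMod q, w l * ‖A (h * l)‖ ^ 2 := by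
      rw [← Finset.sum_fiberwise (V ×ˢ V) (fun z => z.1 - z.2)]
      refine Finset.sum_congr rfl fun l _ => ?_
      rw [Finset.sum_congr rfl (g := fun _ => ‖A (h * l)‖ ^ 2)]
      · simp [hw]
      · intro z hz; rw [(Finset.mem_filter.1 hz).2]
    rw [h2, Finset.card_product] at h1
    push_cast at h1
    calc _ ≤ _ := h1
      _ = _ := by ring
  -- Cauchy–Schwarz separates `V` from `U`: the weights give `E(V)`, and dilating by the unit `h`
  -- gives the fourth moment of `A`.
  have s4 : (∑ l : ZMod q, w l * ‖A (h * l)‖ ^ 2) ^ 2 ≤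
      (Finset.addEnergy V V : ℝ) * (q * (Finset.addEnergy U U : ℝ)) := by
    have h1 := Finset.sum_mul_sq_le_sq_mul_sq Finset.univ w (fun l => ‖A (h * l)‖ ^ 2)
    have h2 : ∑ l : ZMod q, (‖A (h * l)‖ ^ 2) ^ 2 = q * (Finset.addEnergy U U : ℝ) := by
      rw [← sum_norm_pow_four_eq_addEnergy]
      rw [← Equiv.sum_comp (Equiv.mulLeft₀ h hh) fun ξ => ‖∑ u ∈ U, ψ (ξ * u)‖ ^ 4]
      refine Finset.sum_congr rfl fun l _ => ?_
      simp only [hA, Equiv.mulLeft₀_apply]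
      ring
    rw [h2, sum_sq_card_sub_eq_addEnergy] at h1
    exact h1
  set X := ∑ l : ZMod q, w l * ‖A (h * l)‖ ^ 2
  set Y := ∑ z ∈ V ×ˢ V, ‖A (h * (z.1 - z.2))‖ with hY
  have hY0 : 0 ≤ Y := Finset.sum_nonneg fun _ _ => norm_nonneg _
  calc ‖S‖ ^ 8 = (‖S‖ ^ 2) ^ 4 := by ring
    _ ≤ (U.card * Y) ^ 4 := by
      gcongr
      exact s1.trans (by gcongr)
    _ = (U.card : ℝ) ^ 4 * (Y ^ 2) ^ 2 := by ring
    _ ≤ (U.card : ℝ) ^ 4 * ((V.card : ℝ) ^ 2 * X) ^ 2 := by gcongr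
    _ = (U.card : ℝ) ^ 4 * (V.card : ℝ) ^ 4 * X ^ 2 := by ring
    _ ≤ (U.card : ℝ) ^ 4 * (V.card : ℝ) ^ 4 *
        ((Finset.addEnergy V V : ℝ) * (q * (Finset.addEnergy U U : ℝ))) := by gcongr
    _ = _ := by ring

theorem norm_stdAddChar_sub_one (x : ZMod q) :
    ‖ψ x - 1‖ = 2 * |Real.sin (Real.pi * x.val / q)| := by
  have h := ZMod.stdAddChar_coe (N := q) (x.val : ℤ)
  have hx : (((x.val : ℤ)) : ZMod q) = x := by simp
  rw [hx] at h
  rw [h]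
  have h2 := Complex.norm_exp_I_mul_ofReal_sub_one (2 * Real.pi * x.val / q)
  rw [show (2 * Real.pi * x.val / q) / 2 = Real.pi * x.val / q by ring, norm_mul,
    Real.norm_eq_abs, Real.norm_eq_abs, abs_two] at h2
  rw [← h2]
  congr 3
  push_cast; ring

/-- Geometric sum. The reciprocal of the distance from `h` to `q ℤ` is replaced by the sum of both
candidates, so that summing over `h` yields two copies of one harmonic sum. -/
theorem norm_sum_Ico_stdAddChar_le {h : ZMod q} (hh : h ≠ 0) {a b : ℕ} (hab : a ≤ b) :
    ‖∑ j ∈ Finset.Ico a b, ψ (h * j)‖ ≤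
      q / 2 * (1 / (h.val : ℝ) + 1 / ((q - h.val : ℕ) : ℝ)) := by
  have hq : 0 < q := (Fact.out : q.Prime).pos
  have hq0 : (0 : ℝ) < q := by exact_mod_cast hq
  have hk0 : 0 < h.val := Nat.pos_of_ne_zero ((ZMod.val_ne_zero h).2 hh)
  have hkq : h.val < q := ZMod.val_lt h
  set k := h.val with hk
  have hk0' : (0 : ℝ) < k := by exact_mod_cast hk0
  have hkq' : (k : ℝ) < q := by exact_mod_cast hkq
  have hsub : ((q - k : ℕ) : ℝ) = q - k := by rw [Nat.cast_sub hkq.le]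
  have hgeom : (∑ j ∈ Finset.Ico a b, ψ (h * j)) * (ψ h - 1) = ψ h ^ b - ψ h ^ a := by
    have : ∀ j : ℕ, ψ (h * j) = ψ h ^ j := fun j => by
      rw [mul_comm, ← nsmul_eq_mul, AddChar.map_nsmul_eq_pow]
    simp_rw [this]
    exact geom_sum_Ico_mul _ hab
  have hnum : ‖ψ h ^ b - ψ h ^ a‖ ≤ 2 := by
    calc _ ≤ ‖ψ h ^ b‖ + ‖ψ h ^ a‖ := norm_sub_le _ _
      _ = 2 := by simp only [norm_pow, norm_stdAddChar_eq_one]; norm_num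
  -- Jordan's inequality `sin x ≥ 2x/π` on `[0, π/2]`, after reflecting when `k > q/2`.
  have hsin : 2 * min (k : ℝ) (q - k) / q ≤ |Real.sin (Real.pi * k / q)| := by
    refine le_trans ?_ (le_abs_self _)
    rcases le_total ((k : ℝ)) (q - k) with hle | hle
    · rw [min_eq_left hle]
      have := Real.mul_le_sin (x := Real.pi * k / q) (by positivity) (by
        rw [div_le_div_iff₀ hq0 two_pos]; nlinarith [Real.pi_pos])
      calc _ = 2 / Real.pi * (Real.pi * k / q) := by field_simp
        _ ≤ _ := this
    · rw [min_eq_right hle]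
      have := Real.mul_le_sin (x := Real.pi * (q - k) / q)
        (by have : (0 : ℝ) ≤ q - k := by linarith
            positivity) (by
        rw [div_le_div_iff₀ hq0 two_pos]; nlinarith [Real.pi_pos])
      rw [← Real.sin_pi_sub]
      calc _ = 2 / Real.pi * (Real.pi * (q - k) / q) := by field_simp
        _ ≤ _ := this
        _ = _ := by congr 1; field_simp
  have hmin : 0 < min (k : ℝ) (q - k) := lt_min hk0' (by linarith)
  have hden : 4 * min (k : ℝ) (q - k) / q ≤ ‖ψ h - 1‖ := by
    rw [norm_stdAddChar_sub_one, ← hk]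
    calc _ = 2 * (2 * min (k : ℝ) (q - k) / q) := by ring
      _ ≤ _ := by gcongr
  have hmain : ‖∑ j ∈ Finset.Ico a b, ψ (h * j)‖ * (4 * min (k : ℝ) (q - k) / q) ≤ 2 := by
    calc _ ≤ ‖∑ j ∈ Finset.Ico a b, ψ (h * j)‖ * ‖ψ h - 1‖ := by gcongr
      _ = ‖ψ h ^ b - ψ h ^ a‖ := by rw [← norm_mul, hgeom]
      _ ≤ 2 := hnum
  have h3 : ‖∑ j ∈ Finset.Ico a b, ψ (h * j)‖ ≤ q / 2 * (1 / min (k : ℝ) (q - k)) := by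
    rw [← le_div_iff₀ (by positivity)] at hmain
    refine hmain.trans (le_of_eq ?_)
    field_simp; norm_num
  refine h3.trans ?_
  rw [hsub]
  gcongr
  have e1 : 0 < 1 / (k : ℝ) := by positivity
  have e2 : 0 < 1 / ((q : ℝ) - k) := by
    have : (0 : ℝ) < q - k := by linarith
    positivity
  rcases min_choice (k : ℝ) (q - k) with hm | hm <;> rw [hm] <;> linarith

theorem sum_norm_sum_Ico_stdAddChar_le {a b : ℕ} (hab : a ≤ b) :
    ∑ h ∈ Finset.univ.erase (0 : ZMod q), ‖∑ j ∈ Finset.Ico a b, ψ (h * j)‖ ≤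
      q * (1 + Real.log q) := by
  have hq : 0 < q := (Fact.out : q.Prime).pos
  have hbij : ∑ h ∈ Finset.univ.erase (0 : ZMod q),
      ((q : ℝ) / 2 * (1 / (h.val : ℝ) + 1 / ((q - h.val : ℕ) : ℝ))) =
      ∑ k ∈ Finset.Ico 1 q, ((q : ℝ) / 2 * (1 / (k : ℝ) + 1 / ((q - k : ℕ) : ℝ))) := by
    refine Finset.sum_bij (fun h _ => h.val) ?_ ?_ ?_ ?_
    · intro h hh
      simp only [Finset.mem_erase, Finset.mem_univ, and_true] at hh
      exact Finset.mem_Ico.2 ⟨Nat.pos_of_ne_zero ((ZMod.val_ne_zero h).2 hh), ZMod.val_lt h⟩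
    · intro x _ y _ hxy
      exact ZMod.val_injective q hxy
    · intro k hk
      rw [Finset.mem_Ico] at hk
      have hv : ((k : ZMod q)).val = k := ZMod.val_cast_of_lt hk.2
      refine ⟨(k : ZMod q), ?_, hv⟩
      simp only [Finset.mem_erase, Finset.mem_univ, and_true]
      rw [← ZMod.val_ne_zero, hv]; omega
    · intro _ _; rfl
  have hharm : ∑ k ∈ Finset.Ico 1 q, 1 / (k : ℝ) ≤ 1 + Real.log q := by
    refine le_trans ?_ (sum_Icc_inv_le q)
    simp only [one_div]
    refine Finset.sum_le_sum_of_subset_of_nonneg ?_ fun _ _ _ => by positivity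
    intro k hk
    simp only [Finset.mem_Ico, Finset.mem_Icc] at *
    omega
  have hrefl : ∑ k ∈ Finset.Ico 1 q, 1 / ((q - k : ℕ) : ℝ) = ∑ k ∈ Finset.Ico 1 q, 1 / (k : ℝ) := by
    refine Finset.sum_bij (fun k _ => q - k) ?_ ?_ ?_ ?_
    · intro k hk; rw [Finset.mem_Ico] at *; omega
    · intro x hx y hy hxy; rw [Finset.mem_Ico] at *; omega
    · intro k hk; rw [Finset.mem_Ico] at hk
      exact ⟨q - k, by rw [Finset.mem_Ico]; omega, by omega⟩
    · intro _ _; rfl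
  calc _ ≤ ∑ h ∈ Finset.univ.erase (0 : ZMod q),
        ((q : ℝ) / 2 * (1 / (h.val : ℝ) + 1 / ((q - h.val : ℕ) : ℝ))) :=
        Finset.sum_le_sum fun h hh => norm_sum_Ico_stdAddChar_le (Finset.ne_of_mem_erase hh) hab
    _ = q * ∑ k ∈ Finset.Ico 1 q, 1 / (k : ℝ) := by
        rw [hbij, ← Finset.mul_sum, Finset.sum_add_distrib, hrefl]; ring
    _ ≤ _ := by gcongr

/-- Completion: the number of members of a family of residues in an interval deviates from the
expected value by at most `(1 + log q) B` if all its nontrivial exponential sums are at most `B`. -/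
theorem abs_card_filter_Ico_sub_le {ι : Type*} (s : Finset ι) (x : ι → ℕ) (hx : ∀ i ∈ s, x i < q)
    {a b : ℕ} (hab : a ≤ b) (hb : b ≤ q) {B : ℝ}
    (hB : ∀ h : ZMod q, h ≠ 0 → ‖∑ i ∈ s, ψ (h * (x i : ZMod q))‖ ≤ B) :
    |((s.filter fun i => a ≤ x i ∧ x i < b).card : ℝ) - ((b : ℝ) - a) / q * s.card| ≤
      (1 + Real.log q) * B := by
  have hq : 0 < q := (Fact.out : q.Prime).pos
  have hq0 : (0 : ℝ) < q := by exact_mod_cast hq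
  set J : ZMod q → ℂ := fun h => ∑ j ∈ Finset.Ico a b, ψ (h * j) with hJ
  set S : ZMod q → ℂ := fun h => ∑ i ∈ s, ψ (h * (x i : ZMod q)) with hS
  -- Orthogonality detects `j = x i`. The term `h = 0` is the expected value, the others are the
  -- error.
  have hcount : ∑ h : ZMod q, J h * S (-h) =
      (q : ℂ) * ((s.filter fun i => a ≤ x i ∧ x i < b).card : ℂ) := by
    simp only [hJ, hS, Finset.sum_mul_sum]
    rw [Finset.sum_comm]
    simp_rw [Finset.sum_comm (s := Finset.univ) (t := s)]
    rw [Finset.sum_comm, Finset.card_filter]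
    push_cast
    rw [Finset.mul_sum]
    refine Finset.sum_congr rfl fun i hi => ?_
    have : ∀ j ∈ Finset.Ico a b, ∑ h : ZMod q, ψ (h * j) * ψ (-h * (x i : ZMod q)) =
        if j = x i then (q : ℂ) else 0 := by
      intro j hj
      rw [Finset.mem_Ico] at hj
      have h1 : ∀ h : ZMod q, ψ (h * j) * ψ (-h * (x i : ZMod q)) =
          ψ (h * ((j : ZMod q) - (x i : ZMod q))) := by
        intro h
        rw [← AddChar.map_add_eq_mul]; congr 1; ring
      simp_rw [h1]
      have h2 : (j : ZMod q) - (x i : ZMod q) = 0 ↔ j = x i := by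
        rw [sub_eq_zero, ZMod.natCast_eq_natCast_iff]
        exact ⟨fun h => Nat.ModEq.eq_of_lt_of_lt h (by omega) (hx i hi), fun h => h ▸ rfl⟩
      rw [sum_stdAddChar_mul]
      simp only [h2]
    rw [Finset.sum_congr rfl this, Finset.sum_ite_eq']
    simp only [Finset.mem_Ico]
    split_ifs <;> simp
  have hzero : J 0 * S (-0) = (((b : ℝ) - a) * s.card : ℝ) := by
    simp [hJ, hS, Nat.cast_sub hab]
  rw [← Finset.add_sum_erase _ _ (Finset.mem_univ (0 : ZMod q)), hzero] at hcount
  have hrest : ‖∑ h ∈ Finset.univ.erase (0 : ZMod q), J h * S (-h)‖ ≤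
      q * (1 + Real.log q) * B := by
    calc _ ≤ ∑ h ∈ Finset.univ.erase (0 : ZMod q), ‖J h * S (-h)‖ := norm_sum_le _ _
      _ ≤ ∑ h ∈ Finset.univ.erase (0 : ZMod q), ‖J h‖ * B := by
          refine Finset.sum_le_sum fun h hh => ?_
          rw [norm_mul]
          gcongr
          exact hB _ (neg_ne_zero.2 (Finset.ne_of_mem_erase hh))
      _ = (∑ h ∈ Finset.univ.erase (0 : ZMod q), ‖J h‖) * B := by rw [Finset.sum_mul]
      _ ≤ _ := by
          refine mul_le_mul_of_nonneg_right (sum_norm_sum_Ico_stdAddChar_le hab) ?_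
          exact (norm_nonneg _).trans (hB 1 one_ne_zero)
  have hrest' : ∑ h ∈ Finset.univ.erase (0 : ZMod q), J h * S (-h) =
      ((q * (((s.filter fun i => a ≤ x i ∧ x i < b).card : ℝ) -
        ((b : ℝ) - a) / q * s.card) : ℝ) : ℂ) := by
    have hqC : (q : ℂ) ≠ 0 := by exact_mod_cast hq.ne'
    rw [eq_sub_of_add_eq' hcount]
    push_cast
    field_simp
  rw [hrest', Complex.norm_real, Real.norm_eq_abs, abs_mul, abs_of_pos hq0, mul_assoc] at hrest
  exact le_of_mul_le_mul_left hrest hq0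

end AdditiveCharacters

/-! ### Points of a modular lattice in a box -/

/-- Lattice points of the modular lattice `{(x, y) : κ x ≡ y mod q}` in a box. -/
noncomputable def modularBox {q : ℕ} (κ : ZMod q) (A B : ℕ) : Finset (ℤ × ℤ) :=
  (Finset.Icc (-(A : ℤ)) A ×ˢ Finset.Icc (-(B : ℤ)) B).filter fun z => κ * (z.1 : ZMod q) = z.2

theorem mem_modularBox {q : ℕ} {κ : ZMod q} {A B : ℕ} {z : ℤ × ℤ} :
    z ∈ modularBox κ A B ↔ |z.1| ≤ A ∧ |z.2| ≤ B ∧ κ * (z.1 : ZMod q) = z.2 := by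
  simp only [modularBox, Finset.mem_filter, Finset.mem_product, Finset.mem_Icc, abs_le, and_assoc]

/-- A lattice vector collinear with a nonzero vector of least norm is an integer multiple of it. -/
theorem exists_eq_zsmul_of_minimal {q : ℕ} {κ : ZMod q} {A B : ℤ} (hA : 0 < A) (hB : 0 < B)
    {v : ℤ × ℤ} (hv0 : v ≠ 0) (hv : κ * (v.1 : ZMod q) = v.2)
    (hmin : ∀ w : ℤ × ℤ, w ≠ 0 → κ * (w.1 : ZMod q) = w.2 →
      max (B * |v.1|) (A * |v.2|) ≤ max (B * |w.1|) (A * |w.2|))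
    {z : ℤ × ℤ} (hz : κ * (z.1 : ZMod q) = z.2) (hdet : v.1 * z.2 = v.2 * z.1) :
    ∃ t : ℤ, z = (t * v.1, t * v.2) := by
  have hsub : ∀ t : ℤ, κ * ((z.1 - t * v.1 : ℤ) : ZMod q) = ((z.2 - t * v.2 : ℤ) : ZMod q) := by
    intro t
    push_cast
    rw [← hz, ← hv]; ring
  -- Subtracting `t v` stays in the lattice, so a remainder strictly shorter than `v` vanishes; `t`
  -- will come from Euclidean division in a nonzero coordinate of `v`.
  have hcon : ∀ t : ℤ, max (B * |z.1 - t * v.1|) (A * |z.2 - t * v.2|) <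
      max (B * |v.1|) (A * |v.2|) → z = (t * v.1, t * v.2) := by
    intro t ht
    by_contra hne
    have := hmin (z.1 - t * v.1, z.2 - t * v.2) (fun h0 => hne ?_) (hsub t)
    · exact absurd ht (not_lt.2 this)
    · rw [Prod.mk_eq_zero] at h0
      ext <;> simp <;> omega
  by_cases h1 : v.1 = 0
  · have h2 : v.2 ≠ 0 := fun h2 => hv0 (Prod.ext h1 h2)
    have hz1 : z.1 = 0 := by
      rw [h1, zero_mul, eq_comm, mul_eq_zero] at hdet
      exact hdet.resolve_left h2
    refine ⟨z.2 / v.2, hcon _ ?_⟩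
    have hr : z.2 - z.2 / v.2 * v.2 = z.2 % v.2 := by
      rw [Int.emod_def]; ring
    rw [hr, hz1, h1, abs_of_nonneg (Int.emod_nonneg _ h2)]
    have h3 := Int.emod_lt_abs z.2 h2
    have h4 : 0 < |v.2| := abs_pos.2 h2
    simp only [mul_zero, sub_zero, abs_zero]
    rw [max_lt_iff]
    exact ⟨lt_max_of_lt_right (by positivity), lt_max_of_lt_right (by nlinarith)⟩
  · refine ⟨z.1 / v.1, hcon _ ?_⟩
    set t := z.1 / v.1
    have hr : z.1 - t * v.1 = z.1 % v.1 := by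
      rw [Int.emod_def]; ring
    have h3 := Int.emod_lt_abs z.1 h1
    have h4 : 0 < |v.1| := abs_pos.2 h1
    have h0 := Int.emod_nonneg z.1 h1
    have hprod : v.1 * (z.2 - t * v.2) = v.2 * (z.1 % v.1) := by
      rw [← hr, mul_sub, hdet]; ring
    have habs : |v.1| * |z.2 - t * v.2| = |v.2| * (z.1 % v.1) := by
      rw [← abs_mul, hprod, abs_mul, abs_of_nonneg h0]
    rw [hr, abs_of_nonneg h0, max_lt_iff]
    refine ⟨lt_max_of_lt_left (by nlinarith), ?_⟩
    by_cases h2 : v.2 = 0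
    · have : |z.2 - t * v.2| = 0 := by
        have h6 : |v.1| * |z.2 - t * v.2| = 0 := by rw [habs, h2, abs_zero, zero_mul]
        exact (mul_eq_zero.1 h6).resolve_left h4.ne'
      rw [this, mul_zero]
      exact lt_max_of_lt_left (by positivity)
    · have h5 : 0 < |v.2| := abs_pos.2 h2
      refine lt_max_of_lt_right ?_
      have : |z.2 - t * v.2| < |v.2| := by
        have : |v.1| * |z.2 - t * v.2| < |v.1| * |v.2| := by rw [habs]; nlinarith
        exact lt_of_mul_lt_mul_left this h4.le
      nlinarith

/-- The number of points of a modular lattice in a box, in terms of a shortest vector. -/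
theorem exists_shortVector_card_modularBox_le {q : ℕ} (hq : 0 < q) (κ : ZMod q) {A B : ℕ}
    (hA : 0 < A) (hB : 0 < B) :
    ∃ (a : ℕ) (b : ℤ), (a ≠ 0 ∨ b ≠ 0) ∧ κ * (a : ZMod q) = b ∧
      ((modularBox κ A B).card : ℝ) ≤
        20 * (A * B / q) + 5 * (A * B / max ((B : ℝ) * a) (A * |(b : ℝ)|)) + 1 := by
  -- The norm is scaled so that the box is the ball `N ≤ A B`.
  set N : ℤ × ℤ → ℤ := fun v => max (B * |v.1|) (A * |v.2|) with hN
  obtain ⟨v, ⟨hv0, hv⟩, hmin'⟩ := (measure fun v => (N v).toNat).wf.has_min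
    {v : ℤ × ℤ | v ≠ 0 ∧ κ * (v.1 : ZMod q) = v.2}
    ⟨((q : ℤ), 0), by simp [hq.ne'], by simp⟩
  have hNnn : ∀ w, 0 ≤ N w := fun w => le_max_of_le_left (by positivity)
  have hmin : ∀ w : ℤ × ℤ, w ≠ 0 → κ * (w.1 : ZMod q) = w.2 → N v ≤ N w := by
    intro w hw0 hw
    have := hmin' w ⟨hw0, hw⟩
    simp only [WellFoundedRelation.rel, InvImage] at this
    have h1 := hNnn w
    have h2 := hNnn v
    omega
  have hA' : (0 : ℤ) < A := by exact_mod_cast hA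
  have hB' : (0 : ℤ) < B := by exact_mod_cast hB
  have hNv : 0 < N v := by
    by_contra hle
    push Not at hle
    have h1 : (B : ℤ) * |v.1| ≤ 0 := (le_max_left _ _).trans hle
    have h2 : (A : ℤ) * |v.2| ≤ 0 := (le_max_right _ _).trans hle
    have h3 : |v.1| ≤ 0 := by nlinarith [abs_nonneg v.1]
    have h4 : |v.2| ≤ 0 := by nlinarith [abs_nonneg v.2]
    exact hv0 (Prod.ext (abs_nonpos_iff.1 h3) (abs_nonpos_iff.1 h4))
  set S := modularBox κ A B with hS
  have hNS : ∀ w ∈ S, N w ≤ A * B := by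
    intro w hw
    obtain ⟨h1, h2, -⟩ := mem_modularBox.1 hw
    refine max_le ?_ ?_ <;> nlinarith
  have hAR : (0 : ℝ) < A := by exact_mod_cast hA
  have hBR : (0 : ℝ) < B := by exact_mod_cast hB
  have hqR : (0 : ℝ) < q := by exact_mod_cast hq
  have hNR : (0 : ℝ) < (N v : ℝ) := by exact_mod_cast hNv
  have hcard : (S.card : ℝ) ≤ 20 * (A * B / q) + 5 * (A * B / (N v : ℝ)) + 1 := by
    by_cases htriv : S ⊆ {0}
    · have h1 : S.card ≤ 1 := (Finset.card_le_card htriv).trans (by simp)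
      have h1' : (S.card : ℝ) ≤ 1 := by exact_mod_cast h1
      have h2 : (0 : ℝ) ≤ 20 * (A * B / q) + 5 * (A * B / (N v : ℝ)) := by positivity
      linarith
    obtain ⟨w₁, hw₁, hw₁0⟩ := Finset.not_subset.1 htriv
    rw [Finset.mem_singleton] at hw₁0
    have hNAB : N v ≤ A * B := (hmin w₁ hw₁0 (mem_modularBox.1 hw₁).2.2).trans (hNS w₁ hw₁)
    -- The determinant against `v` is a multiple of `q` of size at most `2 N(v)`, hence takes few
    -- values. Points with equal determinant differ by a vector collinear with `v`, hence by a
    -- multiple of it.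
    set f : ℤ × ℤ → ℤ := fun w => v.1 * w.2 - v.2 * w.1 with hf
    set K : ℤ := 2 * N v / q with hK
    set L : ℤ := 2 * (A * B) / N v with hL
    have hK0 : 0 ≤ K := Int.ediv_nonneg (by linarith) (by positivity)
    have hL0 : 0 ≤ L := Int.ediv_nonneg (by positivity) hNv.le
    have himage : (S.image f).card ≤ (2 * K + 1).toNat := by
      have hsub : S.image f ⊆ (Finset.Icc (-K) K).image fun k => (q : ℤ) * k := by
        intro c hc
        obtain ⟨w, hw, rfl⟩ := Finset.mem_image.1 hc
        obtain ⟨h1, h2, h3⟩ := mem_modularBox.1 hw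
        have hdvd : (q : ℤ) ∣ f w := by
          rw [← ZMod.intCast_zmod_eq_zero_iff_dvd]
          simp only [hf]
          push_cast
          rw [← h3, ← hv]; ring
        obtain ⟨k, hk⟩ := hdvd
        refine Finset.mem_image.2 ⟨k, ?_, hk.symm⟩
        have hle : |f w| ≤ 2 * N v := by
          have e1 : (B : ℤ) * |v.1| ≤ N v := le_max_left _ _
          have e2 : (A : ℤ) * |v.2| ≤ N v := le_max_right _ _
          have e3 : |v.1| * |w.2| ≤ |v.1| * B := by gcongr
          have e4 : |v.2| * |w.1| ≤ |v.2| * A := by gcongr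
          calc |f w| ≤ |v.1 * w.2| + |v.2 * w.1| := abs_sub _ _
            _ = |v.1| * |w.2| + |v.2| * |w.1| := by rw [abs_mul, abs_mul]
            _ ≤ _ := by linarith
        have hq' : (0 : ℤ) < q := by exact_mod_cast hq
        rw [hk, abs_mul, abs_of_pos hq'] at hle
        have : |k| ≤ K := by
          rw [hK, Int.le_ediv_iff_mul_le hq']; linarith
        exact Finset.mem_Icc.2 (abs_le.1 this)
      refine (Finset.card_le_card hsub).trans (Finset.card_image_le.trans ?_)
      rw [Int.card_Icc]; omega
    have hfib : ∀ c ∈ S.image f, (S.filter fun w => f w = c).card ≤ (2 * L + 1).toNat := by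
      intro c hc
      obtain ⟨w₀, hw₀, rfl⟩ := Finset.mem_image.1 hc
      have hsub : (S.filter fun w => f w = f w₀) ⊆
          (Finset.Icc (-L) L).image fun t => (w₀.1 + t * v.1, w₀.2 + t * v.2) := by
        intro w hw
        obtain ⟨hwS, hwf⟩ := Finset.mem_filter.1 hw
        have hw3 := (mem_modularBox.1 hwS)
        have hw03 := (mem_modularBox.1 hw₀)
        obtain ⟨t, ht⟩ := exists_eq_zsmul_of_minimal (z := (w.1 - w₀.1, w.2 - w₀.2)) hA' hB' hv0 hv
          hmin (by push_cast; rw [← hw3.2.2, ← hw03.2.2]; ring)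
          (by simp only [hf] at hwf; simp only; linarith)
        rw [Prod.mk.injEq] at ht
        refine Finset.mem_image.2 ⟨t, ?_, by ext <;> simp <;> omega⟩
        have hle : |t| * N v ≤ 2 * (A * B) := by
          have e1 : |t| * |v.1| ≤ 2 * A := by
            rw [← abs_mul, ← ht.1]
            exact (abs_sub _ _).trans (by linarith [hw3.1, hw03.1])
          have e2 : |t| * |v.2| ≤ 2 * B := by
            rw [← abs_mul, ← ht.2]
            exact (abs_sub _ _).trans (by linarith [hw3.2.1, hw03.2.1])
          simp only [hN]
          rw [mul_max_of_nonneg _ _ (abs_nonneg t)]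
          refine max_le ?_ ?_ <;> nlinarith
        have : |t| ≤ L := by rwa [hL, Int.le_ediv_iff_mul_le hNv]
        exact Finset.mem_Icc.2 (abs_le.1 this)
      refine (Finset.card_le_card hsub).trans (Finset.card_image_le.trans ?_)
      rw [Int.card_Icc]; omega
    have hmul := Finset.card_le_mul_card_image (f := f) S _ hfib
    have hmul' : (S.card : ℝ) ≤ (2 * L + 1) * (2 * K + 1) := by
      have h1 : ((2 * L + 1).toNat : ℤ) = 2 * L + 1 := Int.toNat_of_nonneg (by omega)
      have h2 : ((2 * K + 1).toNat : ℤ) = 2 * K + 1 := Int.toNat_of_nonneg (by omega)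
      have h3 : (S.card : ℤ) ≤ (2 * L + 1) * (2 * K + 1) := by
        rw [← h1, ← h2]
        exact_mod_cast hmul.trans (Nat.mul_le_mul_left _ himage)
      exact_mod_cast h3
    have hKR : (K : ℝ) ≤ 2 * (N v) / q := by
      rw [le_div_iff₀ hqR]
      exact_mod_cast Int.ediv_mul_le (2 * N v) (by positivity)
    have hLR : (L : ℝ) ≤ 2 * (A * B) / N v := by
      rw [le_div_iff₀ hNR]
      exact_mod_cast Int.ediv_mul_le (2 * ((A : ℤ) * B)) hNv.ne'
    have hNABR : (N v : ℝ) ≤ A * B := by exact_mod_cast hNAB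
    have hL0R : (0 : ℝ) ≤ L := by exact_mod_cast hL0
    calc (S.card : ℝ) ≤ (2 * L + 1) * (2 * K + 1) := hmul'
      _ ≤ (2 * (2 * (A * B) / N v) + 1) * (2 * (2 * (N v) / q) + 1) := by
          gcongr
      _ = 16 * (A * B / q) + 4 * (A * B / N v) + 4 * (N v / q) + 1 := by
          field_simp; ring
      -- A nonzero lattice point in the box forces `N v ≤ A B`.
      _ ≤ 16 * (A * B / q) + 4 * (A * B / N v) + 4 * (A * B / q) + 1 := by gcongr
      _ ≤ _ := by
          have : (0 : ℝ) ≤ A * B / (N v : ℝ) := by positivity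
          linarith
  have hNcast : ∀ a : ℕ, |v.1| = a → ∀ b : ℤ, |v.2| = |b| →
      (N v : ℝ) = max ((B : ℝ) * a) (A * |(b : ℝ)|) := by
    intro a ha b hb
    simp only [hN, ha, hb]
    push_cast
    rfl
  -- Replacing `v` by `-v` if needed makes the first coordinate a natural number.
  rcases le_total 0 v.1 with h | h
  · refine ⟨v.1.toNat, v.2, ?_, ?_, ?_⟩
    · by_contra! hcon
      exact hv0 (Prod.ext (by simp; omega) hcon.2)
    · rw [← hv]; congr 1
      rw [← Int.cast_natCast, Int.toNat_of_nonneg h]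
    · rw [← hNcast _ (by rw [abs_of_nonneg h, Int.toNat_of_nonneg h]) _ rfl]
      exact hcard
  · refine ⟨(-v.1).toNat, -v.2, ?_, ?_, ?_⟩
    · by_contra! hcon
      exact hv0 (Prod.ext (by simp; omega) (by simp; omega))
    · rw [← Int.cast_natCast, Int.toNat_of_nonneg (by omega)]
      push_cast
      rw [← hv]; ring
    · rw [← hNcast _ (by rw [abs_of_nonpos h, Int.toNat_of_nonneg (by omega)]) _ (abs_neg _).symm]
      exact hcard

/-! ### Additive energy of modular square roots -/

theorem card_le_two_of_sq_eq {F : Type*} [Field F] [DecidableEq F] (s : Finset F) (c : F)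
    (hs : ∀ x ∈ s, x ^ 2 = c) : s.card ≤ 2 := by
  rcases s.eq_empty_or_nonempty with rfl | ⟨x₀, hx₀⟩
  · simp
  · refine (Finset.card_le_card (t := {x₀, -x₀}) fun x hx => ?_).trans Finset.card_le_two
    have : x ^ 2 = x₀ ^ 2 := (hs x hx).trans (hs x₀ hx₀).symm
    simpa using sq_eq_sq_iff_eq_or_eq_neg.1 this

theorem card_le_two_mul_card_divisors {s : Finset ℤ} {n : ℤ} (hn : n ≠ 0) (hs : ∀ e ∈ s, e ∣ n) :
    s.card ≤ 2 * n.natAbs.divisors.card := by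
  classical
  have hsub : s ⊆ n.natAbs.divisors.image (fun k : ℕ => (k : ℤ)) ∪
      n.natAbs.divisors.image (fun k : ℕ => -(k : ℤ)) := by
    intro e he
    have hmem : e.natAbs ∈ n.natAbs.divisors :=
      Nat.mem_divisors.2 ⟨Int.natAbs_dvd_natAbs.2 (hs e he), by simpa using hn⟩
    rw [Finset.mem_union, Finset.mem_image, Finset.mem_image]
    rcases Int.natAbs_eq e with h | h
    · exact Or.inl ⟨_, hmem, h.symm⟩
    · exact Or.inr ⟨_, hmem, h.symm⟩
  calc s.card ≤ _ := Finset.card_le_card hsub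
    _ ≤ _ := Finset.card_union_le _ _
    _ ≤ n.natAbs.divisors.card + n.natAbs.divisors.card :=
        add_le_add Finset.card_image_le Finset.card_image_le
    _ = _ := by ring

/-- A set of integers whose differences of squares fall in few classes is small. -/
theorem sq_card_le_of_sq_sub_sq_mem {ι : Type*} [DecidableEq ι] (Z : Finset ι) (d y : ι → ℤ)
    (hd : Set.InjOn d Z) (T : Finset (ℤ × ℤ))
    (hT : ∀ z ∈ Z, ∀ w ∈ Z, (d z ^ 2 - d w ^ 2, y z - y w) ∈ T) (D : ℕ)
    (hD : ∀ t ∈ T, t.1 ≠ 0 → t.1.natAbs.divisors.card ≤ D) :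
    Z.card ^ 2 ≤ 2 * Z.card + 2 * D * T.card := by
  set f : ι × ι → ℤ × ℤ := fun z => (d z.1 ^ 2 - d z.2 ^ 2, y z.1 - y z.2) with hf
  have hsplit := Finset.card_filter_add_card_filter_not (s := Z ×ˢ Z) (fun z => (f z).1 = 0)
  have h0 : ((Z ×ˢ Z).filter fun z => (f z).1 = 0).card ≤ 2 * Z.card := by
    set W := (Z ×ˢ Z).filter fun z => (f z).1 = 0
    have hfib : ∀ z ∈ W.image Prod.fst, (W.filter fun w => w.1 = z).card ≤ 2 := by
      intro z _
      refine (Finset.card_le_card_of_injOn (t := {d z, -d z}) (fun w => d w.2) ?_ ?_).trans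
        Finset.card_le_two
      · intro w hw
        simp only [W, hf, Finset.coe_filter, Finset.mem_filter, Finset.mem_product,
          Set.mem_ofPred_eq] at hw
        have : d w.2 ^ 2 = d z ^ 2 := by rw [← hw.2]; linarith [hw.1.2]
        simpa using sq_eq_sq_iff_eq_or_eq_neg.1 this
      · intro w hw w' hw' hww
        simp only [W, Finset.coe_filter, Finset.mem_filter, Finset.mem_product,
          Set.mem_ofPred_eq] at hw hw'
        exact Prod.ext (hw.2.trans hw'.2.symm) (hd hw.1.1.2 hw'.1.1.2 hww)
    refine (Finset.card_le_mul_card_image W 2 hfib).trans ?_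
    gcongr
    intro z hz
    obtain ⟨w, hw, rfl⟩ := Finset.mem_image.1 hz
    exact (Finset.mem_product.1 (Finset.mem_filter.1 hw).1).1
  have h1 : ((Z ×ˢ Z).filter fun z => ¬ (f z).1 = 0).card ≤ 2 * D * T.card := by
    set W := (Z ×ˢ Z).filter fun z => ¬ (f z).1 = 0
    have hWT : W.image f ⊆ T := by
      intro t ht
      obtain ⟨w, hw, rfl⟩ := Finset.mem_image.1 ht
      obtain ⟨h1, h2⟩ := Finset.mem_product.1 (Finset.mem_filter.1 hw).1
      exact hT _ h1 _ h2
    have hfib : ∀ t ∈ W.image f, (W.filter fun w => f w = t).card ≤ 2 * D := by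
      intro t ht
      have ht0 : t.1 ≠ 0 := by
        obtain ⟨w, hw, rfl⟩ := Finset.mem_image.1 ht
        exact (Finset.mem_filter.1 hw).2
      have hmem : ∀ w ∈ W.filter (fun w => f w = t), w.1 ∈ Z ∧ w.2 ∈ Z ∧
          (d w.1 - d w.2) * (d w.1 + d w.2) = t.1 := by
        intro w hw
        simp only [W, Finset.mem_filter, Finset.mem_product] at hw
        refine ⟨hw.1.1.1, hw.1.1.2, ?_⟩
        rw [← hw.2]; simp only [hf]; ring
      -- The difference of the two `d`-values divides `t.1 ≠ 0`, and its cofactor is their sum; so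
      -- the divisor determines the pair.
      have hinj : Set.InjOn (fun w : ι × ι => d w.1 - d w.2) (W.filter fun w => f w = t) := by
        intro w hw w' hw' hww
        obtain ⟨a1, a2, a3⟩ := hmem w hw
        obtain ⟨b1, b2, b3⟩ := hmem w' hw'
        simp only at hww
        have hne : d w'.1 - d w'.2 ≠ 0 := fun h => ht0 (by rw [← b3, h, zero_mul])
        have hs : d w.1 + d w.2 = d w'.1 + d w'.2 := by
          rw [hww, ← b3] at a3
          exact mul_left_cancel₀ hne a3
        exact Prod.ext (hd a1 b1 (by omega)) (hd a2 b2 (by omega))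
      rw [← Finset.card_image_of_injOn hinj]
      refine (card_le_two_mul_card_divisors ht0 ?_).trans
        (Nat.mul_le_mul_left _ (hD t (hWT ht) ht0))
      intro e he
      obtain ⟨w, hw, rfl⟩ := Finset.mem_image.1 he
      exact ⟨_, (hmem w hw).2.2.symm⟩
    exact (Finset.card_le_mul_card_image W _ hfib).trans
      (Nat.mul_le_mul_left _ (Finset.card_le_card hWT))
  rw [sq, ← Finset.card_product, ← hsplit]
  exact add_le_add h0 h1

/-- The number of ways to write a nonzero residue as a sum of two square roots of multiples
`c m` with `1 ≤ m ≤ M`, in terms of a short vector of a modular lattice. -/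
theorem exists_shortVector_sq_card_add_eq_le {q : ℕ} [Fact q.Prime] (hq2 : q ≠ 2) {c : ZMod q}
    (hc : c ≠ 0) {M : ℕ} (hM : 1 ≤ M) (U : Finset (ZMod q)) (m : ZMod q → ℕ)
    (hm : ∀ u ∈ U, 1 ≤ m u ∧ m u ≤ M ∧ u ^ 2 = c * m u) {D : ℕ}
    (hD : ∀ n : ℕ, n ≠ 0 → n ≤ M ^ 2 → n.divisors.card ≤ D) {l : ZMod q} (hl : l ≠ 0) :
    ∃ (a : ℕ) (b : ℤ), (a ≠ 0 ∨ b ≠ 0) ∧ c / l ^ 2 * (a : ZMod q) = b ∧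
      (((U ×ˢ U).filter fun z => z.1 + z.2 = l).card : ℝ) ^ 2 ≤
        2 * (((U ×ˢ U).filter fun z => z.1 + z.2 = l).card : ℝ) +
          2 * D * (20 * ((M : ℝ) ^ 2 * (4 * M) / q) +
            5 * ((M : ℝ) ^ 2 * (4 * M) / max ((4 * M : ℝ) * a) ((M : ℝ) ^ 2 * |(b : ℝ)|)) + 1) := by
  have hqp : q.Prime := Fact.out
  obtain ⟨a, b, hab, hκ, hcard⟩ := exists_shortVector_card_modularBox_le hqp.pos (c / l ^ 2)
    (A := M ^ 2) (B := 4 * M) (by positivity) (by positivity)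
  refine ⟨a, b, hab, hκ, ?_⟩
  push_cast at hcard
  set Z := (U ×ˢ U).filter fun z => z.1 + z.2 = l with hZ
  set d : ZMod q × ZMod q → ℤ := fun z => (m z.1 : ℤ) - m z.2 with hd
  set y : ZMod q × ZMod q → ℤ := fun z => 2 * ((m z.1 : ℤ) + m z.2) with hy
  have h2 : (2 : ZMod q) ≠ 0 := by
    intro h
    have h' : ((2 : ℕ) : ZMod q) = 0 := by exact_mod_cast h
    rw [ZMod.natCast_eq_zero_iff, Nat.prime_dvd_prime_iff_eq hqp Nat.prime_two] at h'
    exact hq2 h'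
  have hmem : ∀ z ∈ Z, z.1 ∈ U ∧ z.2 ∈ U ∧ z.1 + z.2 = l := by
    intro z hz
    simpa [hZ, and_assoc] using hz
  -- For `u + v = l` one has `2 l u = l² + (u² - v²)`: the value `d` recovers the solution, which
  -- gives injectivity.
  have hlin : ∀ z ∈ Z, 2 * l * z.1 = l ^ 2 + c * (d z : ZMod q) := by
    intro z hz
    obtain ⟨h1, h2, h3⟩ := hmem z hz
    have e1 := (hm _ h1).2.2
    have e2 := (hm _ h2).2.2
    simp only [hd]
    push_cast
    rw [mul_sub, ← e1, ← e2, ← h3]; ring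
  -- This is `(u² - v²)² + (u + v)⁴ = 2 (u + v)² (u² + v²)`. Subtracting two instances cancels `l⁴`
  -- and leaves a linear congruence.
  have hquad : ∀ z ∈ Z, c ^ 2 * (d z : ZMod q) ^ 2 + l ^ 4 = c * l ^ 2 * (y z : ZMod q) := by
    intro z hz
    obtain ⟨h1, h2, h3⟩ := hmem z hz
    have e1 := (hm _ h1).2.2
    have e2 := (hm _ h2).2.2
    have e3 : c * (d z : ZMod q) = z.1 ^ 2 - z.2 ^ 2 := by
      simp only [hd]; push_cast; rw [mul_sub, ← e1, ← e2]
    have e4 : c * (y z : ZMod q) = 2 * (z.1 ^ 2 + z.2 ^ 2) := by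
      simp only [hy]; push_cast; rw [e1, e2]; ring
    calc _ = (c * (d z : ZMod q)) ^ 2 + l ^ 4 := by ring
      _ = l ^ 2 * (c * (y z : ZMod q)) := by rw [e3, e4, ← h3]; ring
      _ = _ := by ring
  have hinj : Set.InjOn d Z := by
    intro z hz w hw hzw
    have e : 2 * l * z.1 = 2 * l * w.1 := by rw [hlin z hz, hlin w hw, hzw]
    have e1 : z.1 = w.1 := mul_left_cancel₀ (mul_ne_zero h2 hl) e
    refine Prod.ext e1 ?_
    have e2 := (hmem z hz).2.2.trans (hmem w hw).2.2.symm
    rw [e1] at e2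
    exact add_left_cancel e2
  have hmain := sq_card_le_of_sq_sub_sq_mem Z d y hinj (modularBox (c / l ^ 2) (M ^ 2) (4 * M))
    (fun z hz w hw => by
      obtain ⟨z1, z2, -⟩ := hmem z hz
      obtain ⟨w1, w2, -⟩ := hmem w hw
      have a1 := hm _ z1
      have a2 := hm _ z2
      have a3 := hm _ w1
      have a4 := hm _ w2
      rw [mem_modularBox]
      refine ⟨?_, ?_, ?_⟩
      · have b1 : d z ^ 2 ≤ M ^ 2 := sq_le_sq' (by simp only [hd]; omega) (by simp only [hd]; omega)
        have b2 : d w ^ 2 ≤ M ^ 2 := sq_le_sq' (by simp only [hd]; omega) (by simp only [hd]; omega)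
        rw [abs_le]
        push_cast
        constructor <;> nlinarith [sq_nonneg (d z), sq_nonneg (d w)]
      · rw [abs_le]
        simp only [hy]
        push_cast
        constructor <;> omega
      · have e1 := hquad z hz
        have e2 := hquad w hw
        push_cast
        rw [div_mul_eq_mul_div, div_eq_iff (pow_ne_zero 2 hl)]
        apply mul_left_cancel₀ hc
        linear_combination e1 - e2) D
    (fun t ht ht0 => hD _ (by simpa using ht0) (by
      have := (mem_modularBox.1 ht).1
      rw [Int.abs_eq_natAbs] at this
      exact_mod_cast this))
  have hmain' : (Z.card : ℝ) ^ 2 ≤ 2 * Z.card +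
      2 * D * (modularBox (c / l ^ 2) (M ^ 2) (4 * M)).card := by exact_mod_cast hmain
  refine hmain'.trans ?_
  gcongr

/-- Few residues `l` have a short vector in the lattice attached to `c / l ^ 2`. -/
theorem sum_inv_shortVector_le {q : ℕ} [Fact q.Prime] {c : ZMod q} (hc : c ≠ 0)
    (Λ : Finset (ZMod q)) (a : ZMod q → ℕ) (b : ZMod q → ℤ) {A Y : ℕ}
    (hl : ∀ l ∈ Λ, l ≠ 0) (hκ : ∀ l ∈ Λ, c / l ^ 2 * (a l : ZMod q) = b l)
    (ha0 : ∀ l ∈ Λ, (a l : ZMod q) ≠ 0) (haA : ∀ l ∈ Λ, a l ≤ A) (hbY : ∀ l ∈ Λ, |b l| ≤ Y) :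
    ∑ l ∈ Λ, (a l : ℝ)⁻¹ ≤ 2 * (2 * Y + 1) * (1 + Real.log A) := by
  set box := Finset.Icc 1 A ×ˢ Finset.Icc (-(Y : ℤ)) Y with hbox
  have hmaps : ∀ l ∈ Λ, (a l, b l) ∈ box := by
    intro l hlΛ
    have h1 : a l ≠ 0 := fun h => ha0 l hlΛ (by simp [h])
    rw [hbox, Finset.mem_product, Finset.mem_Icc, Finset.mem_Icc]
    exact ⟨⟨Nat.one_le_iff_ne_zero.2 h1, haA l hlΛ⟩, abs_le.1 (hbY l hlΛ)⟩
  calc ∑ l ∈ Λ, (a l : ℝ)⁻¹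
      = ∑ v ∈ box, ∑ l ∈ Λ.filter (fun l => (a l, b l) = v), (a l : ℝ)⁻¹ :=
        (Finset.sum_fiberwise_of_maps_to hmaps _).symm
    _ ≤ ∑ v ∈ box, 2 * (v.1 : ℝ)⁻¹ := by
        refine Finset.sum_le_sum fun v _ => ?_
        rw [Finset.sum_congr rfl (g := fun _ => (v.1 : ℝ)⁻¹)]
        · rw [Finset.sum_const, nsmul_eq_mul]
          gcongr
          rw [← Nat.cast_two, Nat.cast_le]
          -- The congruence `(c / l²) a = b` fixes `l² = c a / b`, so at most two `l` share a
          -- vector.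
          refine card_le_two_of_sq_eq _ (c * (v.1 : ZMod q) / (v.2 : ZMod q)) fun l hlv => ?_
          obtain ⟨hlΛ, rfl⟩ := Finset.mem_filter.1 hlv
          have h0 := pow_ne_zero 2 (hl l hlΛ)
          have hb0 : (b l : ZMod q) ≠ 0 := by
            rw [← hκ l hlΛ]
            exact mul_ne_zero (div_ne_zero hc h0) (ha0 l hlΛ)
          rw [eq_div_iff hb0, ← hκ l hlΛ, ← mul_assoc, mul_div_cancel₀ _ h0]
        · intro l hlv
          rw [← (Finset.mem_filter.1 hlv).2]
    _ = 2 * (2 * Y + 1) * ∑ k ∈ Finset.Icc 1 A, (k : ℝ)⁻¹ := by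
        rw [hbox, Finset.sum_product]
        simp only [Finset.sum_const, Int.card_Icc, nsmul_eq_mul]
        rw [Finset.mul_sum]
        refine Finset.sum_congr rfl fun k _ => ?_
        have : (((Y : ℤ) + 1 - -Y).toNat : ℝ) = 2 * Y + 1 := by
          have : ((Y : ℤ) + 1 - -Y).toNat = 2 * Y + 1 := by omega
          rw [this]; push_cast; ring
        rw [this]; ring
    _ ≤ _ := by
        gcongr
        exact sum_Icc_inv_le A

theorem card_le_two_mul_of_sq_eq_mul {q : ℕ} [Fact q.Prime] {c : ZMod q} {M : ℕ}
    (U : Finset (ZMod q)) (m : ZMod q → ℕ)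
    (hm : ∀ u ∈ U, 1 ≤ m u ∧ m u ≤ M ∧ u ^ 2 = c * m u) : U.card ≤ 2 * M := by
  refine (Finset.card_le_mul_card_image (f := m) U 2 ?_).trans ?_
  · intro k _
    refine card_le_two_of_sq_eq _ (c * k) fun u hu => ?_
    obtain ⟨h1, rfl⟩ := Finset.mem_filter.1 hu
    exact (hm u h1).2.2
  · gcongr
    calc (U.image m).card ≤ (Finset.Icc 1 M).card := Finset.card_le_card fun k hk => by
          obtain ⟨u, hu, rfl⟩ := Finset.mem_image.1 hk
          exact Finset.mem_Icc.2 ⟨(hm u hu).1, (hm u hu).2.1⟩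
      _ = M := by simp

set_option maxHeartbeats 1000000 in
/-- The additive energy of modular square roots of `c m`, `1 ≤ m ≤ M`. -/
theorem addEnergy_modular_sqrt_le {q : ℕ} [Fact q.Prime] (hq2 : q ≠ 2) {c : ZMod q}
    (hc : c ≠ 0) {M : ℕ} (hM : 1 ≤ M) (U : Finset (ZMod q))
    (hU : ∀ u ∈ U, ∃ m : ℕ, 1 ≤ m ∧ m ≤ M ∧ u ^ 2 = c * m) {D : ℕ}
    (hD : ∀ n : ℕ, n ≠ 0 → n ≤ M ^ 2 → n.divisors.card ≤ D) :
    (Finset.addEnergy U U : ℝ) ≤ 3000 * D * (1 + Real.log ((M : ℝ) ^ 2)) * (M : ℝ) ^ 2 *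
      (Real.sqrt ((M : ℝ) ^ 3 / q) + (M : ℝ) ^ (1 / 3 : ℝ)) := by
  have hqp : q.Prime := Fact.out
  have hq0 : (0 : ℝ) < q := by exact_mod_cast hqp.pos
  choose! m hm using hU
  set ω : ℝ := (M : ℝ) ^ (1 / 3 : ℝ) with hω
  have hM1 : (1 : ℝ) ≤ M := by exact_mod_cast hM
  have hM0 : (0 : ℝ) < M := by linarith
  have hω3 : ω ^ 3 = M := by
    rw [hω, ← Real.rpow_natCast, ← Real.rpow_mul hM0.le]; norm_num
  have hω1 : 1 ≤ ω := Real.one_le_rpow hM1 (by norm_num)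
  have hω0 : 0 < ω := by linarith
  set ρ : ℝ := Real.sqrt ((M : ℝ) ^ 3 / q) with hρ
  have hρ0 : 0 ≤ ρ := Real.sqrt_nonneg _
  have hρ2 : ρ ^ 2 = (M : ℝ) ^ 3 / q := Real.sq_sqrt (by positivity)
  have hD1 : (1 : ℝ) ≤ D := by
    have := hD 1 one_ne_zero (Nat.one_le_pow _ _ hM)
    rw [Nat.divisors_one, Finset.card_singleton] at this
    exact_mod_cast this
  have hlog : 0 ≤ Real.log ((M : ℝ) ^ 2) := Real.log_nonneg (one_le_pow₀ hM1)
  have hUcard : (U.card : ℝ) ≤ 2 * M := by exact_mod_cast card_le_two_mul_of_sq_eq_mul U m hm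
  set r : ZMod q → ℝ := fun l => (((U ×ˢ U).filter fun z => z.1 + z.2 = l).card : ℝ) with hr
  have hr0 : ∀ l, 0 ≤ r l := fun l => Nat.cast_nonneg _
  have hE : (Finset.addEnergy U U : ℝ) = ∑ l : ZMod q, r l ^ 2 := by
    rw [Finset.addEnergy_eq_sum_sq]; push_cast; rfl
  have hrsum : ∑ l : ZMod q, r l ≤ 4 * (M : ℝ) ^ 2 := by
    have : ∑ l : ZMod q, r l = (U.card : ℝ) ^ 2 := by
      simp only [hr]
      rw [← Nat.cast_sum, ← Finset.card_eq_sum_card_fiberwise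
        (fun _ _ => Finset.mem_coe.2 (Finset.mem_univ _)), Finset.card_product]
      push_cast; ring
    rw [this]
    nlinarith [(Nat.cast_nonneg U.card : (0 : ℝ) ≤ U.card)]
  -- The residue `0` has no lattice `c / l²`; here the first summand determines the second.
  have hr00 : r 0 ≤ 2 * M := by
    refine le_trans ?_ hUcard
    simp only [hr]
    rw [Nat.cast_le]
    refine Finset.card_le_card_of_injOn Prod.fst ?_ ?_
    · intro z hz
      simp only [Finset.coe_filter, Finset.mem_product, Set.mem_ofPred_eq] at hz
      exact hz.1.1
    · intro z hz w hw hzw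
      simp only [Finset.coe_filter, Finset.mem_product, Set.mem_ofPred_eq] at hz hw
      refine Prod.ext hzw ?_
      have h := hz.2.trans hw.2.symm
      rw [hzw] at h
      exact add_left_cancel h
  have hshort := fun (l : ZMod q) (hl : l ≠ 0) =>
    exists_shortVector_sq_card_add_eq_le hq2 hc hM U m hm hD hl
  choose! a b hab hκ hbound using hshort
  set N : ZMod q → ℝ := fun l => max ((4 * M : ℝ) * a l) ((M : ℝ) ^ 2 * |(b l : ℝ)|) with hN
  have hN0 : ∀ l, l ≠ 0 → 0 < N l := by
    intro l hl
    rcases hab l hl with h | h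
    · have : (0 : ℝ) < a l := by exact_mod_cast Nat.pos_of_ne_zero h
      exact lt_max_of_lt_left (by positivity)
    · have : (0 : ℝ) < |(b l : ℝ)| := abs_pos.2 (by exact_mod_cast h)
      exact lt_max_of_lt_right (by positivity)
  set T : ZMod q → ℝ := fun l => (M : ℝ) ^ 2 * (4 * M) / N l with hT
  -- Threshold for a short vector: `16 ρ²` prevents `q ∣ a`, `1` gives `a ≤ M²`, and `ω²` gives `|b|
  -- ≤ 4 ω`.
  set T₁ : ℝ := 16 * ρ ^ 2 + 1 + ω ^ 2 with hT₁
  have hT₁1 : 1 ≤ T₁ := by rw [hT₁]; nlinarith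
  have hr2 : ∀ l, l ≠ 0 → r l ^ 2 ≤ 60 * D * (T₁ + T l) := by
    intro l hl
    have h1 := hbound l hl
    have hT0 : 0 ≤ T l := by have := hN0 l hl; simp only [hT]; positivity
    have h2 : r l ^ 2 ≤ 2 * r l + 2 * D * (80 * ρ ^ 2 + 5 * T l + 1) := by
      refine h1.trans (le_of_eq ?_)
      rw [hρ2]; simp only [hr, hT, hN]; ring
    -- Absorbs the linear term into half of `r²`.
    have h3 : 2 * r l ≤ r l ^ 2 / 2 + 2 := by nlinarith [sq_nonneg (r l - 2)]
    have h4 : (1 : ℝ) ≤ D * (80 * ρ ^ 2 + 5 * T l + 1) := by nlinarith [sq_nonneg ρ]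
    have h5 : D * (80 * ρ ^ 2 + 5 * T l + 1) ≤ D * (5 * (T₁ + T l)) := by
      gcongr
      rw [hT₁]; nlinarith
    nlinarith
  set bad := (Finset.univ.erase (0 : ZMod q)).filter fun l => T₁ < T l with hbad
  set good := (Finset.univ.erase (0 : ZMod q)).filter fun l => ¬ T₁ < T l with hgood
  have hsplit : ∑ l : ZMod q, r l ^ 2 = r 0 ^ 2 + (∑ l ∈ bad, r l ^ 2 + ∑ l ∈ good, r l ^ 2) := by
    rw [← Finset.add_sum_erase _ _ (Finset.mem_univ (0 : ZMod q)),
      Finset.sum_filter_add_sum_filter_not]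
  -- residues without a short vector
  have hgoodr : ∀ l ∈ good, r l ≤ 11 * D * (4 * ρ + 2 * ω) := by
    intro l hl
    simp only [hgood, Finset.mem_filter, Finset.mem_erase, Finset.mem_univ, and_true,
      not_lt] at hl
    have h1 := hr2 l hl.1
    have h2 : r l ^ 2 ≤ 120 * D * T₁ := by nlinarith [hl.2]
    refine abs_le_of_sq_le_sq' (h2.trans ?_) (by positivity) |>.2
    have h3 : T₁ ≤ (4 * ρ + 2 * ω) ^ 2 := by rw [hT₁]; nlinarith [mul_nonneg hρ0 hω0.le]
    calc 120 * D * T₁ ≤ 120 * D * (4 * ρ + 2 * ω) ^ 2 := by gcongr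
      _ ≤ 121 * (D * D) * (4 * ρ + 2 * ω) ^ 2 := by
          have h4 : (D : ℝ) ≤ D * D := le_mul_of_one_le_right (by linarith) hD1
          gcongr
          linarith
      _ = _ := by ring
  have hgoodsum : ∑ l ∈ good, r l ^ 2 ≤ 11 * D * (4 * ρ + 2 * ω) * (4 * (M : ℝ) ^ 2) := by
    calc ∑ l ∈ good, r l ^ 2 ≤ ∑ l ∈ good, 11 * D * (4 * ρ + 2 * ω) * r l := by
          refine Finset.sum_le_sum fun l hl => ?_
          rw [sq]
          exact mul_le_mul_of_nonneg_right (hgoodr l hl) (hr0 l)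
      _ = 11 * D * (4 * ρ + 2 * ω) * ∑ l ∈ good, r l := by rw [Finset.mul_sum]
      _ ≤ _ := by
          gcongr
          exact (Finset.sum_le_univ_sum_of_nonneg hr0).trans hrsum
  -- residues with a short vector
  have hbadmem : ∀ l ∈ bad, l ≠ 0 ∧ T₁ < T l := by
    intro l hl
    simpa [hbad] using hl
  have hbadN : ∀ l ∈ bad, T₁ * N l < (M : ℝ) ^ 2 * (4 * M) := by
    intro l hl
    obtain ⟨h1, h2⟩ := hbadmem l hl
    exact (lt_div_iff₀ (hN0 l h1)).1 h2
  have hNa : ∀ l, (4 * M : ℝ) * a l ≤ N l := fun l => le_max_left _ _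
  have hNb : ∀ l, (M : ℝ) ^ 2 * |(b l : ℝ)| ≤ N l := fun l => le_max_right _ _
  -- If `q ∣ a` then `q ∣ b`, so the nonzero vector has a coordinate of size at least `q`, too long
  -- for a bad residue.
  have ha0 : ∀ l ∈ bad, (a l : ZMod q) ≠ 0 := by
    intro l hl hza
    obtain ⟨h1, h2⟩ := hbadmem l hl
    have hzb : (b l : ZMod q) = 0 := by rw [← hκ l h1, hza, mul_zero]
    have hlt := hbadN l hl
    have hT₁q : 16 * (M : ℝ) ^ 3 ≤ T₁ * q := by
      have : ρ ^ 2 * q = (M : ℝ) ^ 3 := by rw [hρ2]; field_simp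
      rw [hT₁]; nlinarith [mul_nonneg (sq_nonneg ω) hq0.le]
    rcases hab l h1 with h | h
    · have hqa : (q : ℝ) ≤ a l := by
        exact_mod_cast Nat.le_of_dvd (Nat.pos_of_ne_zero h) ((ZMod.natCast_eq_zero_iff _ _).1 hza)
      have e1 : T₁ * ((4 * M : ℝ) * q) ≤ T₁ * N l := by
        have := hNa l
        gcongr
        exact le_trans (by gcongr) this
      have e2 : (M : ℝ) * (16 * (M : ℝ) ^ 3) ≤ M * (T₁ * q) := by gcongr
      have e3 : (M : ℝ) ^ 3 ≤ M ^ 4 := pow_le_pow_right₀ hM1 (by norm_num)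
      nlinarith [pow_pos hM0 4]
    · have hqb : (q : ℝ) ≤ |(b l : ℝ)| := by
        have h3 := Int.le_of_dvd (abs_pos.2 h)
          ((dvd_abs _ _).2 ((ZMod.intCast_zmod_eq_zero_iff_dvd _ _).1 hzb))
        exact_mod_cast h3
      have e1 : T₁ * ((M : ℝ) ^ 2 * q) ≤ T₁ * N l := by
        have := hNb l
        gcongr
        exact le_trans (by gcongr) this
      have e2 : (M : ℝ) ^ 2 * (16 * (M : ℝ) ^ 3) ≤ M ^ 2 * (T₁ * q) := by gcongr
      have e3 : (M : ℝ) ^ 3 ≤ M ^ 5 := pow_le_pow_right₀ hM1 (by norm_num)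
      nlinarith [pow_pos hM0 5]
  have haA : ∀ l ∈ bad, a l ≤ M ^ 2 := by
    intro l hl
    have h1 := hbadN l hl
    have h2 : N l ≤ T₁ * N l := le_mul_of_one_le_left (hN0 l (hbadmem l hl).1).le hT₁1
    have h3 : (4 * M : ℝ) * a l ≤ (4 * M) * M ^ 2 := by linarith [hNa l]
    exact_mod_cast le_of_mul_le_mul_left h3 (by positivity)
  have hbY : ∀ l ∈ bad, |b l| ≤ (⌊4 * ω⌋₊ : ℕ) := by
    intro l hl
    have h1 := hbadN l hl
    have h2 : ω ^ 2 ≤ T₁ := by rw [hT₁]; nlinarith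
    have h3 : ω ^ 2 * ((M : ℝ) ^ 2 * |(b l : ℝ)|) ≤ (M : ℝ) ^ 2 * (4 * M) :=
      (mul_le_mul h2 (hNb l) (by positivity) (by linarith)).trans h1.le
    have h4 : |(b l : ℝ)| ≤ 4 * ω := by
      have : (ω ^ 2 * (M : ℝ) ^ 2) * |(b l : ℝ)| ≤ (ω ^ 2 * (M : ℝ) ^ 2) * (4 * ω) := by
        calc _ = ω ^ 2 * ((M : ℝ) ^ 2 * |(b l : ℝ)|) := by ring
          _ ≤ _ := h3
          _ = _ := by
            have : ω ^ 2 * (M : ℝ) ^ 2 * (4 * ω) = (M : ℝ) ^ 2 * (4 * ω ^ 3) := by ring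
            rw [this, hω3]
      exact le_of_mul_le_mul_left this (by positivity)
    rw [Int.abs_eq_natAbs, Nat.cast_le]
    apply Nat.le_floor
    rwa [Nat.cast_natAbs, Int.cast_abs]
  have hinv := sum_inv_shortVector_le hc bad a b (fun l hl => (hbadmem l hl).1)
    (fun l hl => hκ l (hbadmem l hl).1) ha0 haA hbY
  have hfloor : ((⌊4 * ω⌋₊ : ℕ) : ℝ) ≤ 4 * ω := Nat.floor_le (by positivity)
  have hinv' : ∑ l ∈ bad, (a l : ℝ)⁻¹ ≤ 18 * ω * (1 + Real.log ((M : ℝ) ^ 2)) := by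
    push_cast at hinv
    refine hinv.trans (mul_le_mul_of_nonneg_right ?_ (by linarith))
    linarith
  have hTa : ∀ l ∈ bad, T l ≤ (M : ℝ) ^ 2 * (a l : ℝ)⁻¹ := by
    intro l hl
    have h1 : (0 : ℝ) < a l := by
      have : a l ≠ 0 := fun h => ha0 l hl (by simp [h])
      exact_mod_cast Nat.pos_of_ne_zero this
    simp only [hT]
    rw [div_le_iff₀ (hN0 l (hbadmem l hl).1)]
    calc (M : ℝ) ^ 2 * (4 * M) = (M : ℝ) ^ 2 * (a l : ℝ)⁻¹ * (4 * M * a l) := by field_simp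
      _ ≤ _ := by gcongr; exact hNa l
  have hbadsum : ∑ l ∈ bad, r l ^ 2 ≤
      120 * D * ((M : ℝ) ^ 2 * (18 * ω * (1 + Real.log ((M : ℝ) ^ 2)))) := by
    calc ∑ l ∈ bad, r l ^ 2 ≤ ∑ l ∈ bad, 120 * D * ((M : ℝ) ^ 2 * (a l : ℝ)⁻¹) := by
          refine Finset.sum_le_sum fun l hl => ?_
          obtain ⟨h1, h2⟩ := hbadmem l hl
          calc r l ^ 2 ≤ 60 * D * (T₁ + T l) := hr2 l h1
            _ ≤ 60 * D * (T l + T l) := by gcongr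
            _ = 120 * D * T l := by ring
            _ ≤ _ := by gcongr; exact hTa l hl
      _ = 120 * D * ((M : ℝ) ^ 2 * ∑ l ∈ bad, (a l : ℝ)⁻¹) := by
          rw [Finset.mul_sum, Finset.mul_sum]
      _ ≤ _ := by gcongr
  set G := 1 + Real.log ((M : ℝ) ^ 2) with hG
  have hG1 : 1 ≤ G := by linarith
  rw [hE, hsplit]
  have hr0sq : r 0 ^ 2 ≤ 4 * (M : ℝ) ^ 2 := by nlinarith [hr0 0]
  have hDG : (D : ℝ) ≤ D * G := le_mul_of_one_le_right (by linarith) hG1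
  have k1 : 4 * (M : ℝ) ^ 2 ≤ 4 * (D * G) * (M : ℝ) ^ 2 * ω := by
    have : (1 : ℝ) ≤ D * G * ω := one_le_mul_of_one_le_of_one_le (by linarith) hω1
    calc 4 * (M : ℝ) ^ 2 = 4 * (M : ℝ) ^ 2 * 1 := by ring
      _ ≤ 4 * (M : ℝ) ^ 2 * (D * G * ω) := by gcongr
      _ = _ := by ring
  have k2 : 11 * D * (4 * ρ + 2 * ω) * (4 * (M : ℝ) ^ 2) ≤
      11 * (D * G) * (4 * ρ + 2 * ω) * (4 * (M : ℝ) ^ 2) := by gcongr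
  have k3 : 0 ≤ (D * G) * (M : ℝ) ^ 2 * ω := by positivity
  have k4 : 0 ≤ (D * G) * (M : ℝ) ^ 2 * ρ := by positivity
  -- The coefficients are `4 + 88 + 2160` for `ω` and `176` for `ρ`, all within `3000`.
  nlinarith

/-! ### Roots of products of primes as products of roots -/

/-- The primes up to `P`. -/
def primesUpTo (P : ℕ) : Finset ℕ := (Finset.range (P + 1)).filter Nat.Prime

theorem mem_primesUpTo {P p : ℕ} : p ∈ primesUpTo P ↔ p ≤ P ∧ p.Prime := by
  simp [primesUpTo]

theorem card_primesUpTo_le (P : ℕ) : (primesUpTo P).card ≤ P := by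
  calc (primesUpTo P).card ≤ (Finset.Icc 1 P).card := Finset.card_le_card fun p hp => by
        rw [mem_primesUpTo] at hp
        exact Finset.mem_Icc.2 ⟨hp.2.one_le, hp.1⟩
    _ = P := by simp

theorem sum_primeProductRoots {q : ℕ} [NeZero q] (P R : ℕ) {E : Type*} [AddCommMonoid E]
    (f : ZMod q → E) :
    ∑ t ∈ primeProductRoots q P R, f (t.2.2 : ZMod q) =
      ∑ p ∈ primesUpTo P, ∑ r ∈ primesUpTo R,
        ∑ x ∈ Finset.univ.filter (fun x : ZMod q => x ^ 2 = (p : ZMod q) * r), f x := by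
  rw [primeProductRoots, Finset.sum_filter, Finset.sum_product, primesUpTo, Finset.sum_filter]
  refine Finset.sum_congr rfl fun p _ => ?_
  rw [Finset.sum_product, primesUpTo, Finset.sum_filter]
  split_ifs with hp
  · refine Finset.sum_congr rfl fun r _ => ?_
    split_ifs with hr
    · rw [← Finset.sum_filter]
      refine Finset.sum_bij' (fun x _ => (x : ZMod q)) (fun x _ => x.val) ?_ ?_ ?_ ?_ ?_
      · intro x hx
        rw [Finset.mem_filter] at hx
        rw [Finset.mem_filter]
        refine ⟨Finset.mem_univ _, ?_⟩
        exact_mod_cast (ZMod.natCast_eq_natCast_iff _ _ _).2 hx.2.2.2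
      · intro x hx
        rw [Finset.mem_filter] at hx
        rw [Finset.mem_filter, Finset.mem_range]
        refine ⟨ZMod.val_lt x, hp, hr, ?_⟩
        rw [← ZMod.natCast_eq_natCast_iff]
        push_cast
        rw [ZMod.natCast_zmod_val]
        exact hx.2
      · intro x hx
        rw [Finset.mem_filter, Finset.mem_range] at hx
        exact ZMod.val_cast_of_lt hx.1
      · intro x _
        exact ZMod.natCast_zmod_val x
      · intro _ _; rfl
    · exact Finset.sum_eq_zero fun x _ => if_neg fun h => hr h.2.1
  · exact Finset.sum_eq_zero fun r _ => Finset.sum_eq_zero fun x _ => if_neg fun h => hp h.1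

theorem card_primeProductRoots_le {q : ℕ} [Fact q.Prime] (P R : ℕ) :
    (primeProductRoots q P R).card ≤ 2 * (P * R) := by
  have h := sum_primeProductRoots (q := q) P R (fun _ => 1)
  simp only [Finset.sum_const, smul_eq_mul, mul_one] at h
  rw [h]
  calc _ ≤ ∑ p ∈ primesUpTo P, ∑ r ∈ primesUpTo R, 2 :=
        Finset.sum_le_sum fun p _ => Finset.sum_le_sum fun r _ =>
          card_le_two_of_sq_eq _ _ fun x hx => (Finset.mem_filter.1 hx).2
    _ = (primesUpTo P).card * ((primesUpTo R).card * 2) := by simp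
    _ ≤ P * (R * 2) := by
        gcongr
        · exact card_primesUpTo_le P
        · exact card_primesUpTo_le R
    _ = _ := by ring

/-- The number of roots of `b` is `1 + χ(b)`, and `χ(g a) = -χ(a)`; for `a = 0` each set is `{0}`.
-/
theorem card_sqrts_add_card_sqrts_mul {q : ℕ} [Fact q.Prime] (hq2 : q ≠ 2) {g : ZMod q}
    (hg : ¬ IsSquare g) (a : ZMod q) :
    (Finset.univ.filter fun x : ZMod q => x ^ 2 = a).card +
      (Finset.univ.filter fun x : ZMod q => x ^ 2 = g * a).card = 2 := by
  have hchar : ringChar (ZMod q) ≠ 2 := by rwa [ZMod.ringChar_zmod_n]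
  have key : ∀ b : ZMod q, ((Finset.univ.filter fun x : ZMod q => x ^ 2 = b).card : ℤ) =
      quadraticChar (ZMod q) b + 1 := by
    intro b
    rw [← quadraticChar_card_sqrts hchar b]
    congr 2
    ext x; simp
  have h1 := key a
  have h2 := key (g * a)
  rw [map_mul, quadraticChar_neg_one_iff_not_isSquare.2 hg] at h2
  have : (((Finset.univ.filter fun x : ZMod q => x ^ 2 = a).card +
      (Finset.univ.filter fun x : ZMod q => x ^ 2 = g * a).card : ℕ) : ℤ) = 2 := by
    push_cast; rw [h1, h2]; ring
  exact_mod_cast this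

/-- Square roots of a product of residues as products of square roots, where `g` is a fixed
nonresidue. -/
theorem sum_sqrt_mul_sqrt {q : ℕ} [Fact q.Prime] (hq2 : q ≠ 2) {g : ZMod q} (hg : ¬ IsSquare g)
    (p r : ZMod q) (f : ZMod q → ℂ) :
    (∑ u ∈ Finset.univ.filter (fun u : ZMod q => u ^ 2 = 1 * p),
      ∑ v ∈ Finset.univ.filter (fun v : ZMod q => v ^ 2 = 1⁻¹ * r), f (u * v)) +
    (∑ u ∈ Finset.univ.filter (fun u : ZMod q => u ^ 2 = g * p),
      ∑ v ∈ Finset.univ.filter (fun v : ZMod q => v ^ 2 = g⁻¹ * r), f (u * v)) =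
    2 * ∑ x ∈ Finset.univ.filter (fun x : ZMod q => x ^ 2 = p * r), f x := by
  have hg0 : g ≠ 0 := fun h => hg (h ▸ IsSquare.zero)
  -- This case is needed since the prime `p = q` is allowed. Then `u = 0` and only the total number
  -- of `v` matters.
  by_cases hp : p = 0
  · subst hp
    have h0 : (Finset.univ.filter fun x : ZMod q => x ^ 2 = 0) = {0} := by
      ext x; simp
    have hg' : ¬ IsSquare g⁻¹ := fun h => hg (by simpa using h.inv)
    have hcount := card_sqrts_add_card_sqrts_mul hq2 hg' r
    simp only [mul_zero, zero_mul, h0, Finset.sum_singleton, Finset.sum_const, inv_one, one_mul]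
    rw [← add_smul, hcount]; simp
  -- For fixed `u ≠ 0`, multiplication by `u` is a bijection onto the roots of `p r`; the two
  -- families of `u` have two members in total.
  · have hinner : ∀ c : ZMod q, c ≠ 0 → ∀ u : ZMod q, u ^ 2 = c * p →
        ∑ v ∈ Finset.univ.filter (fun v : ZMod q => v ^ 2 = c⁻¹ * r), f (u * v) =
          ∑ x ∈ Finset.univ.filter (fun x : ZMod q => x ^ 2 = p * r), f x := by
      intro c hc u hu
      have hu0 : u ≠ 0 := by
        rintro rfl
        rw [zero_pow two_ne_zero, eq_comm, mul_eq_zero] at hu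
        exact hu.elim hc hp
      refine Finset.sum_bij' (fun v _ => u * v) (fun x _ => u⁻¹ * x) ?_ ?_ ?_ ?_ ?_
      · intro v hv
        simp only [Finset.mem_filter, Finset.mem_univ, true_and] at *
        rw [mul_pow, hu, hv]; field_simp
      · intro x hx
        simp only [Finset.mem_filter, Finset.mem_univ, true_and] at *
        rw [mul_pow, inv_pow, hu, hx]; field_simp
      · intro v _; field_simp
      · intro x _; field_simp
      · intro v _; rfl
    rw [Finset.sum_congr rfl fun u hu => hinner 1 one_ne_zero u (Finset.mem_filter.1 hu).2,
      Finset.sum_congr rfl fun u hu => hinner g hg0 u (Finset.mem_filter.1 hu).2,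
      Finset.sum_const, Finset.sum_const, ← add_smul, one_mul,
      card_sqrts_add_card_sqrts_mul hq2 hg p]
    simp

/-- The square roots modulo `q` of `c p`, where `p` runs over the primes up to `P`. -/
noncomputable def primeRoots {q : ℕ} [NeZero q] (c : ZMod q) (P : ℕ) : Finset (ZMod q) :=
  (primesUpTo P).biUnion fun p => Finset.univ.filter fun u : ZMod q => u ^ 2 = c * p

/-- Primes up to `q` are pairwise incongruent, `q` itself being the only one congruent to `0`, so
the root sets are disjoint. -/
theorem sum_primeRoots {q : ℕ} [Fact q.Prime] {c : ZMod q} (hc : c ≠ 0) {P : ℕ} (hP : P ≤ q)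
    (f : ZMod q → ℂ) :
    ∑ u ∈ primeRoots c P, f u = ∑ p ∈ primesUpTo P,
      ∑ u ∈ Finset.univ.filter (fun u : ZMod q => u ^ 2 = c * p), f u := by
  rw [primeRoots, Finset.sum_biUnion]
  intro p hp p' hp' hne
  rw [Function.onFun, Finset.disjoint_left]
  intro u hu hu'
  simp only [Finset.mem_filter, Finset.mem_univ, true_and] at hu hu'
  rw [Finset.mem_coe, mem_primesUpTo] at hp hp'
  have h1 : (p : ZMod q) = p' := mul_left_cancel₀ hc (hu.symm.trans hu')
  rw [ZMod.natCast_eq_natCast_iff'] at h1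
  have hpos := hp.2.pos
  have hpos' := hp'.2.pos
  rcases (hp.1.trans hP).lt_or_eq with h | h <;> rcases (hp'.1.trans hP).lt_or_eq with h' | h'
  · rw [Nat.mod_eq_of_lt h, Nat.mod_eq_of_lt h'] at h1; exact hne h1
  · rw [Nat.mod_eq_of_lt h, h', Nat.mod_self] at h1; omega
  · rw [Nat.mod_eq_of_lt h', h, Nat.mod_self] at h1; omega
  · exact hne (h.trans h'.symm)

theorem exists_sq_eq_of_mem_primeRoots {q : ℕ} [NeZero q] {c : ZMod q} {P : ℕ} :
    ∀ u ∈ primeRoots c P, ∃ m : ℕ, 1 ≤ m ∧ m ≤ P ∧ u ^ 2 = c * m := by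
  intro u hu
  obtain ⟨p, hp, hu⟩ := Finset.mem_biUnion.1 hu
  rw [mem_primesUpTo] at hp
  exact ⟨p, hp.2.one_le, hp.1, (Finset.mem_filter.1 hu).2⟩

theorem two_mul_sum_primeProductRoots {q : ℕ} [Fact q.Prime] (hq2 : q ≠ 2) {g : ZMod q}
    (hg : ¬ IsSquare g) {P R : ℕ} (hP : P ≤ q) (hR : R ≤ q) (f : ZMod q → ℂ) :
    2 * ∑ t ∈ primeProductRoots q P R, f (t.2.2 : ZMod q) =
      (∑ u ∈ primeRoots (1 : ZMod q) P, ∑ v ∈ primeRoots (1 : ZMod q)⁻¹ R, f (u * v)) +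
        ∑ u ∈ primeRoots g P, ∑ v ∈ primeRoots g⁻¹ R, f (u * v) := by
  have hg0 : g ≠ 0 := fun h => hg (h ▸ IsSquare.zero)
  have hexpand : ∀ c : ZMod q, c ≠ 0 →
      ∑ u ∈ primeRoots c P, ∑ v ∈ primeRoots c⁻¹ R, f (u * v) =
        ∑ p ∈ primesUpTo P, ∑ r ∈ primesUpTo R,
          ∑ u ∈ Finset.univ.filter (fun u : ZMod q => u ^ 2 = c * p),
            ∑ v ∈ Finset.univ.filter (fun v : ZMod q => v ^ 2 = c⁻¹ * r), f (u * v) := by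
    intro c hc
    rw [sum_primeRoots hc hP]
    refine Finset.sum_congr rfl fun p _ => ?_
    conv_rhs => rw [Finset.sum_comm]
    refine Finset.sum_congr rfl fun u _ => ?_
    rw [sum_primeRoots (inv_ne_zero hc) hR]
  rw [hexpand 1 one_ne_zero, hexpand g hg0, ← Finset.sum_add_distrib, sum_primeProductRoots,
    Finset.mul_sum]
  refine Finset.sum_congr rfl fun p _ => ?_
  rw [← Finset.sum_add_distrib, Finset.mul_sum]
  exact Finset.sum_congr rfl fun r _ => (sum_sqrt_mul_sqrt hq2 hg _ _ f).symm

/-! ### From exponential sums to the discrepancy -/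

theorem discrepancy_le {Ξ : Multiset ℝ} {b : ℝ}
    (h : ∀ α β : ℝ, 0 ≤ α → α < β → β ≤ 1 →
      |(Multiset.countP (fun ξ => α ≤ ξ ∧ ξ < β) Ξ : ℝ) - (β - α) * (Multiset.card Ξ : ℝ)| ≤ b) :
    discrepancy Ξ ≤ b := by
  refine csSup_le ⟨_, 0, 1, le_rfl, one_pos, le_rfl, rfl⟩ ?_
  rintro d ⟨α, β, h0, h1, h2, rfl⟩
  exact h α β h0 h1 h2

theorem discrepancy_le_card (Ξ : Multiset ℝ) : discrepancy Ξ ≤ Multiset.card Ξ := by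
  refine discrepancy_le fun α β h0 h1 h2 => ?_
  have hc : (Multiset.countP (fun ξ => α ≤ ξ ∧ ξ < β) Ξ : ℝ) ≤ Multiset.card Ξ := by
    exact_mod_cast Multiset.countP_le_card _ _
  have hc0 : (0 : ℝ) ≤ Multiset.countP (fun ξ => α ≤ ξ ∧ ξ < β) Ξ := Nat.cast_nonneg _
  have hn : (0 : ℝ) ≤ Multiset.card Ξ := Nat.cast_nonneg _
  rw [abs_le]
  constructor <;> nlinarith

theorem card_primeProductRootPoints (q P R : ℕ) :
    Multiset.card (primeProductRootPoints q P R) = (primeProductRoots q P R).card := by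
  simp [primeProductRootPoints]

/-- The points lie in `q⁻¹ ℤ`, so `[α, β)` may be replaced by the integers from `⌈α q⌉` to `⌈β q⌉ -
1`. Rounding changes the expected count by at most `#Ξ / q`. -/
theorem rootDiscrepancy_le_of_norm_sum_le {q : ℕ} [Fact q.Prime] (P R : ℕ) {B : ℝ}
    (hB : ∀ h : ZMod q, h ≠ 0 →
      ‖∑ t ∈ primeProductRoots q P R, ZMod.stdAddChar (h * (t.2.2 : ZMod q))‖ ≤ B) :
    rootDiscrepancy q P R ≤ (primeProductRoots q P R).card / q + (1 + Real.log q) * B := by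
  have hq0 : (0 : ℝ) < q := by exact_mod_cast (Fact.out : q.Prime).pos
  refine discrepancy_le fun α β h0 h1 h2 => ?_
  set S := primeProductRoots q P R with hS
  set a := ⌈α * q⌉₊ with ha
  set b := ⌈β * q⌉₊ with hb
  have hcount : Multiset.countP (fun ξ => α ≤ ξ ∧ ξ < β) (primeProductRootPoints q P R) =
      (S.filter fun t => a ≤ t.2.2 ∧ t.2.2 < b).card := by
    rw [primeProductRootPoints, Multiset.countP_map, ← hS, Finset.card_def, Finset.filter_val]
    congr 1
    refine Multiset.filter_congr fun t _ => ?_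
    rw [ha, hb, Nat.ceil_le, Nat.lt_ceil, le_div_iff₀ hq0, div_lt_iff₀ hq0]
  have hab : a ≤ b := Nat.ceil_mono (by gcongr)
  have hbq : b ≤ q := by
    rw [hb, Nat.ceil_le]; nlinarith
  have hmain := abs_card_filter_Ico_sub_le S (fun t => t.2.2)
    (fun t ht => by
      simp only [hS, primeProductRoots, Finset.mem_filter, Finset.mem_product,
        Finset.mem_range] at ht
      exact ht.1.2.2) hab hbq hB
  rw [hcount, card_primeProductRootPoints, ← hS]
  have hα : 0 ≤ α * q := by positivity
  have hβ : 0 ≤ β * q := by have : 0 ≤ β := by linarith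
                            positivity
  have e1 := Nat.le_ceil (α * q)
  have e2 := Nat.ceil_lt_add_one hα
  have e3 := Nat.le_ceil (β * q)
  have e4 := Nat.ceil_lt_add_one hβ
  rw [← ha] at e1 e2
  rw [← hb] at e3 e4
  have hround : |((b : ℝ) - a) / q * S.card - (β - α) * S.card| ≤ S.card / q := by
    have : ((b : ℝ) - a) / q * S.card - (β - α) * S.card =
        ((b - β * q) - (a - α * q)) * (S.card / q) := by field_simp; ring
    rw [this, abs_mul, abs_of_nonneg (by positivity : (0 : ℝ) ≤ S.card / q)]
    refine mul_le_of_le_one_left (by positivity) ?_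
    rw [abs_le]; constructor <;> linarith
  calc _ ≤ |((S.filter fun t => a ≤ t.2.2 ∧ t.2.2 < b).card : ℝ) - ((b : ℝ) - a) / q * S.card| +
        |((b : ℝ) - a) / q * S.card - (β - α) * S.card| := abs_sub_le _ _ _
    _ ≤ _ := by linarith

/-! ### Exponents and the bound with an explicit loss -/

/-- Explains the exponents: `M² M^(1/3) = (M^(7/24))⁸`, and `√(M³/q) / M^(1/3)` is the eighth power
of `M^(7/48) / q^(1/16)`. Then `x⁸ + 1 ≤ (x + 1)⁸`. Together with `M^(1/2)` from the cardinality,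
`1/2 + 7/24 = 19/24`. -/
theorem sq_mul_sqrt_add_rpow_le_pow_eight {M q : ℝ} (hM : 0 < M) (hq : 0 < q) :
    M ^ 2 * (Real.sqrt (M ^ 3 / q) + M ^ (1 / 3 : ℝ)) ≤
      (M ^ (7 / 24 : ℝ) * (M ^ (7 / 48 : ℝ) / q ^ (1 / 16 : ℝ) + 1)) ^ 8 := by
  have e1 : (M ^ (7 / 24 : ℝ)) ^ 8 = M ^ 2 * M ^ (1 / 3 : ℝ) := by
    rw [← Real.rpow_natCast, ← Real.rpow_mul hM.le, ← Real.rpow_natCast M 2, ← Real.rpow_add hM]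
    norm_num
  have e2 : (M ^ (7 / 48 : ℝ) / q ^ (1 / 16 : ℝ)) ^ 8 * M ^ (1 / 3 : ℝ) =
      Real.sqrt (M ^ 3 / q) := by
    rw [div_pow, ← Real.rpow_natCast, ← Real.rpow_mul hM.le, ← Real.rpow_natCast,
      ← Real.rpow_mul hq.le, Real.sqrt_eq_rpow, Real.div_rpow (by positivity) hq.le,
      ← Real.rpow_natCast M 3, ← Real.rpow_mul hM.le, div_mul_eq_mul_div, ← Real.rpow_add hM]
    norm_num
  rw [mul_pow, e1]
  have h1 : (M ^ (7 / 48 : ℝ) / q ^ (1 / 16 : ℝ)) ^ 8 + 1 ≤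
      (M ^ (7 / 48 : ℝ) / q ^ (1 / 16 : ℝ) + 1) ^ 8 := by
    have := pow_add_pow_le (x := M ^ (7 / 48 : ℝ) / q ^ (1 / 16 : ℝ)) (y := 1)
      (by positivity) zero_le_one (n := 8) (by norm_num)
    simpa using this
  calc _ = M ^ 2 * M ^ (1 / 3 : ℝ) * ((M ^ (7 / 48 : ℝ) / q ^ (1 / 16 : ℝ)) ^ 8 + 1) := by
        rw [← e2]; ring
    _ ≤ _ := by gcongr

/-- The largest number of divisors of a positive integer up to `V ^ 2`. -/
def maxCardDivisors (V : ℕ) : ℕ := (Finset.Icc 1 (V ^ 2)).sup fun n => n.divisors.card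

theorem card_divisors_le_maxCardDivisors {V n : ℕ} (h0 : n ≠ 0) (hn : n ≤ V ^ 2) :
    n.divisors.card ≤ maxCardDivisors V :=
  Finset.le_sup (f := fun n : ℕ => n.divisors.card)
    (Finset.mem_Icc.2 ⟨Nat.one_le_iff_ne_zero.2 h0, hn⟩)

theorem one_le_maxCardDivisors {V : ℕ} (hV : 1 ≤ V) : 1 ≤ maxCardDivisors V := by
  simpa using card_divisors_le_maxCardDivisors one_ne_zero (Nat.one_le_pow 2 V hV)

/-- The main term of the discrepancy bound. -/
noncomputable def mainBound (q P R : ℕ) : ℝ :=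
  (q : ℝ) ^ (1 / 8 : ℝ) * ((P : ℝ) * (R : ℝ)) ^ (19 / 24 : ℝ) *
    ((P : ℝ) ^ (7 / 48 : ℝ) / (q : ℝ) ^ (1 / 16 : ℝ) + 1) *
    ((R : ℝ) ^ (7 / 48 : ℝ) / (q : ℝ) ^ (1 / 16 : ℝ) + 1)

theorem rpow_mul_rpow_le_mainBound (q P R : ℕ) :
    (q : ℝ) ^ (1 / 8 : ℝ) * ((P : ℝ) * (R : ℝ)) ^ (19 / 24 : ℝ) ≤ mainBound q P R := by
  have h : ∀ M : ℕ, (1 : ℝ) ≤ (M : ℝ) ^ (7 / 48 : ℝ) / (q : ℝ) ^ (1 / 16 : ℝ) + 1 := fun M => by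
    have : (0 : ℝ) ≤ (M : ℝ) ^ (7 / 48 : ℝ) / (q : ℝ) ^ (1 / 16 : ℝ) := by positivity
    linarith
  rw [mainBound, mul_assoc _ _ ((R : ℝ) ^ (7 / 48 : ℝ) / (q : ℝ) ^ (1 / 16 : ℝ) + 1)]
  exact le_mul_of_one_le_right (by positivity) (one_le_mul_of_one_le_of_one_le (h P) (h R))

theorem norm_bilinear_primeRoots_le {q : ℕ} [Fact q.Prime] (hq2 : q ≠ 2) {c : ZMod q}
    (hc : c ≠ 0) {P R : ℕ} (hP : 1 ≤ P) (hR : 1 ≤ R) {h : ZMod q} (hh : h ≠ 0) :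
    ‖∑ u ∈ primeRoots c P, ∑ v ∈ primeRoots c⁻¹ R, ZMod.stdAddChar (h * (u * v))‖ ≤
      16 * maxCardDivisors (P * R) * (1 + 2 * Real.log (P * R)) * mainBound q P R := by
  have hq0 : (0 : ℝ) < q := by exact_mod_cast (Fact.out : q.Prime).pos
  have hP1 : (1 : ℝ) ≤ P := by exact_mod_cast hP
  have hR1 : (1 : ℝ) ≤ R := by exact_mod_cast hR
  have hPR1 : (1 : ℝ) ≤ (P : ℝ) * R := one_le_mul_of_one_le_of_one_le hP1 hR1
  have hlog : 0 ≤ Real.log ((P : ℝ) * R) := Real.log_nonneg hPR1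
  set D := maxCardDivisors (P * R) with hDdef
  set G : ℝ := 1 + 2 * Real.log (P * R) with hG
  have hD1 : (1 : ℝ) ≤ D := by exact_mod_cast one_le_maxCardDivisors (Nat.mul_pos hP hR)
  have hG1 : 1 ≤ G := by linarith
  set w : ℕ → ℝ := fun M =>
    (M : ℝ) ^ (7 / 24 : ℝ) * ((M : ℝ) ^ (7 / 48 : ℝ) / (q : ℝ) ^ (1 / 16 : ℝ) + 1) with hw
  have henergy : ∀ (M : ℕ) (e : ZMod q), 1 ≤ M → M ≤ P * R → e ≠ 0 →
      (Finset.addEnergy (primeRoots e M) (primeRoots e M) : ℝ) ≤ 3000 * D * G * w M ^ 8 := by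
    intro M e hM hMV he
    have hM1 : (1 : ℝ) ≤ M := by exact_mod_cast hM
    have h1 := addEnergy_modular_sqrt_le hq2 he hM (primeRoots e M) exists_sq_eq_of_mem_primeRoots
      (D := D) fun n h0 hn =>
        card_divisors_le_maxCardDivisors h0 (hn.trans (Nat.pow_le_pow_left hMV 2))
    have h2 : 1 + Real.log ((M : ℝ) ^ 2) ≤ G := by
      rw [Real.log_pow, hG]
      push_cast
      have : Real.log M ≤ Real.log ((P : ℝ) * R) :=
        Real.log_le_log (by linarith) (by exact_mod_cast hMV)
      linarith
    have h3 := sq_mul_sqrt_add_rpow_le_pow_eight (M := M) (q := q) (by linarith) hq0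
    calc _ ≤ _ := h1
      _ = 3000 * D * (1 + Real.log ((M : ℝ) ^ 2)) *
          ((M : ℝ) ^ 2 * (Real.sqrt ((M : ℝ) ^ 3 / q) + (M : ℝ) ^ (1 / 3 : ℝ))) := by ring
      _ ≤ _ := by gcongr
  have hcard : ∀ (M : ℕ) (e : ZMod q), ((primeRoots e M).card : ℝ) ≤ 2 * M := by
    intro M e
    have hU := exists_sq_eq_of_mem_primeRoots (c := e) (P := M)
    choose! m hm using hU
    exact_mod_cast card_le_two_mul_of_sq_eq_mul _ m hm
  have hS := norm_bilinear_sum_pow_eight_le (primeRoots c P) (primeRoots c⁻¹ R) hh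
  have hEP := henergy P c hP (Nat.le_mul_of_pos_right P hR) hc
  have hER := henergy R c⁻¹ hR (Nat.le_mul_of_pos_left R hP) (inv_ne_zero hc)
  have hcP := hcard P c
  have hcR := hcard R c⁻¹
  have hmain : mainBound q P R ^ 8 = (P : ℝ) ^ 4 * (R : ℝ) ^ 4 * q * w P ^ 8 * w R ^ 8 := by
    have e1 : ((q : ℝ) ^ (1 / 8 : ℝ)) ^ 8 = q := by
      rw [← Real.rpow_natCast, ← Real.rpow_mul hq0.le]; norm_num
    have e2 : ∀ M : ℕ, 1 ≤ M → ((M : ℝ) ^ (19 / 24 : ℝ)) ^ 8 =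
        (M : ℝ) ^ 4 * ((M : ℝ) ^ (7 / 24 : ℝ)) ^ 8 := by
      intro M hM
      have hM0 : (0 : ℝ) < M := by exact_mod_cast hM
      rw [← Real.rpow_natCast, ← Real.rpow_mul hM0.le, ← Real.rpow_natCast _ 8,
        ← Real.rpow_mul hM0.le, ← Real.rpow_natCast _ 4, ← Real.rpow_add hM0]
      norm_num
    rw [mainBound, Real.mul_rpow (by linarith) (by linarith)]
    simp only [mul_pow, hw, e1, e2 P hP, e2 R hR]
    ring
  have hmb0 : 0 ≤ mainBound q P R := le_trans (by positivity) (rpow_mul_rpow_le_mainBound q P R)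
  refine le_of_pow_le_pow_left₀ (n := 8) (by norm_num) (by positivity) (hS.trans ?_)
  have hDG : 1 ≤ D * G := one_le_mul_of_one_le_of_one_le hD1 hG1
  have hw0 : ∀ M, 0 ≤ w M := fun M => by simp only [hw]; positivity
  calc _ ≤ (2 * (P : ℝ)) ^ 4 * (2 * (R : ℝ)) ^ 4 *
        (q * (3000 * D * G * w P ^ 8) * (3000 * D * G * w R ^ 8)) := by gcongr
    _ = 2304000000 * (D * G) ^ 2 * mainBound q P R ^ 8 := by rw [hmain]; ring
    -- The constant is `16⁸`, rounding up `2⁸ · 3000²` to an eighth power.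
    _ ≤ 4294967296 * (D * G) ^ 8 * mainBound q P R ^ 8 := by
        gcongr
        · norm_num
        · norm_num
    _ = _ := by ring

theorem rootDiscrepancy_le_two_mul {q : ℕ} [Fact q.Prime] (P R : ℕ) :
    rootDiscrepancy q P R ≤ 2 * ((P : ℝ) * R) := by
  refine (discrepancy_le_card _).trans ?_
  rw [card_primeProductRootPoints]
  exact_mod_cast card_primeProductRoots_le P R

/-- The factor lost in the discrepancy bound; it grows more slowly than any power of `V`. -/
noncomputable def lossFactor (V : ℕ) : ℝ :=
  18 * maxCardDivisors V * (1 + 2 * Real.log V) ^ 2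

theorem eighteen_le_lossFactor {V : ℕ} (hV : 1 ≤ V) : 18 ≤ lossFactor V := by
  have hD1 : (1 : ℝ) ≤ maxCardDivisors V := by exact_mod_cast one_le_maxCardDivisors hV
  have hlog : 0 ≤ Real.log V := Real.log_natCast_nonneg V
  have hG : 1 ≤ (1 + 2 * Real.log V) ^ 2 := one_le_pow₀ (by linarith)
  rw [lossFactor, mul_assoc]
  linarith [one_le_mul_of_one_le_of_one_le hD1 hG]

theorem rootDiscrepancy_le_lossFactor_mul {q P R : ℕ} [Fact q.Prime] (hP : 1 ≤ P) (hPq : P ≤ q)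
    (hR : 1 ≤ R) (hRq : R ≤ q) :
    rootDiscrepancy q P R ≤ lossFactor (P * R) * mainBound q P R := by
  have hqp : q.Prime := Fact.out
  have hq1 : (1 : ℝ) ≤ q := by exact_mod_cast hqp.one_le
  have hq0 : (0 : ℝ) < q := by linarith
  have hV1 : 1 ≤ P * R := Nat.mul_pos hP hR
  have hP1 : (1 : ℝ) ≤ P := by exact_mod_cast hP
  have hR1 : (1 : ℝ) ≤ R := by exact_mod_cast hR
  have hPR1 : (1 : ℝ) ≤ (P : ℝ) * R := one_le_mul_of_one_le_of_one_le hP1 hR1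
  have hlow := rpow_mul_rpow_le_mainBound q P R
  have hmb0 : 0 ≤ mainBound q P R := le_trans (by positivity) hlow
  have hloss := eighteen_le_lossFactor hV1
  have htriv : ∀ {X : ℝ}, X ≤ 8 * mainBound q P R → X ≤ lossFactor (P * R) * mainBound q P R :=
    fun hX => hX.trans (by gcongr; linarith)
  have hdisc := rootDiscrepancy_le_two_mul (q := q) P R
  -- Here `P, R ≤ 2`, so the trivial bound is `2 P R ≤ 8`.
  by_cases hq2 : q = 2
  · apply htriv
    have h1 : (1 : ℝ) ≤ mainBound q P R := le_trans
      (one_le_mul_of_one_le_of_one_le (Real.one_le_rpow hq1 (by norm_num))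
        (Real.one_le_rpow hPR1 (by norm_num))) hlow
    have h2 : (P : ℝ) ≤ 2 := by exact_mod_cast hq2 ▸ hPq
    have h3 : (R : ℝ) ≤ 2 := by exact_mod_cast hq2 ▸ hRq
    nlinarith
  have hsplitV : (P : ℝ) * R = (P * R : ℝ) ^ (5 / 24 : ℝ) * (P * R : ℝ) ^ (19 / 24 : ℝ) := by
    rw [← Real.rpow_add (by linarith)]; norm_num
  -- The loss may depend on `PR` only. Up to `q^(3/5)` one has `(PR)^(5/24) ≤ q^(1/8)` and the
  -- trivial bound wins; beyond it `log q ≤ (5/3) log (PR)`.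
  rcases le_or_gt ((P : ℝ) * R) ((q : ℝ) ^ (3 / 5 : ℝ)) with hsmall | hlarge
  · apply htriv
    have h1 : (P * R : ℝ) ^ (5 / 24 : ℝ) ≤ (q : ℝ) ^ (1 / 8 : ℝ) := by
      calc (P * R : ℝ) ^ (5 / 24 : ℝ) ≤ ((q : ℝ) ^ (3 / 5 : ℝ)) ^ (5 / 24 : ℝ) := by gcongr
        _ = _ := by rw [← Real.rpow_mul hq0.le]; norm_num
    have h2 : (P : ℝ) * R ≤ mainBound q P R := by
      refine le_trans ?_ hlow
      conv_lhs => rw [hsplitV]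
      gcongr
    linarith
  · obtain ⟨g, hg⟩ := FiniteField.exists_nonsquare (F := ZMod q) (by rwa [ZMod.ringChar_zmod_n])
    have hg0 : g ≠ 0 := fun h => hg (h ▸ IsSquare.zero)
    set D := maxCardDivisors (P * R) with hDdef
    set G : ℝ := 1 + 2 * Real.log (P * R) with hG
    have hD1 : (1 : ℝ) ≤ D := by exact_mod_cast one_le_maxCardDivisors hV1
    have hlogV : 0 ≤ Real.log ((P : ℝ) * R) := Real.log_nonneg hPR1
    have hG1 : 1 ≤ G := by linarith
    have hB : ∀ h : ZMod q, h ≠ 0 →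
        ‖∑ t ∈ primeProductRoots q P R, ZMod.stdAddChar (h * (t.2.2 : ZMod q))‖ ≤
          16 * D * G * mainBound q P R := by
      intro h hh
      have h1 := two_mul_sum_primeProductRoots hq2 hg hPq hRq fun x => ZMod.stdAddChar (h * x)
      have h2 := norm_bilinear_primeRoots_le hq2 (one_ne_zero (α := ZMod q)) hP hR hh
      have h3 := norm_bilinear_primeRoots_le hq2 hg0 hP hR hh
      have h4 := congrArg norm h1
      rw [norm_mul, Complex.norm_two] at h4
      have h5 := h4.le.trans (norm_add_le _ _)
      linarith
    have hmain := rootDiscrepancy_le_of_norm_sum_le P R hB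
    have hN : ((primeProductRoots q P R).card : ℝ) / q ≤ 2 * mainBound q P R := by
      have h1 : ((primeProductRoots q P R).card : ℝ) ≤ 2 * ((P : ℝ) * R) := by
        exact_mod_cast card_primeProductRoots_le P R
      have h2 : (P * R : ℝ) ^ (5 / 24 : ℝ) ≤ q := by
        have h3 : (P : ℝ) * R ≤ (q : ℝ) ^ (2 : ℝ) := by
          rw [Real.rpow_two, sq]
          exact_mod_cast Nat.mul_le_mul hPq hRq
        calc (P * R : ℝ) ^ (5 / 24 : ℝ) ≤ ((q : ℝ) ^ (2 : ℝ)) ^ (5 / 24 : ℝ) := by gcongr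
          _ = (q : ℝ) ^ (5 / 12 : ℝ) := by rw [← Real.rpow_mul hq0.le]; norm_num
          _ ≤ (q : ℝ) ^ (1 : ℝ) := Real.rpow_le_rpow_of_exponent_le hq1 (by norm_num)
          _ = q := Real.rpow_one _
      have h4 : (P * R : ℝ) ^ (19 / 24 : ℝ) ≤ mainBound q P R :=
        (le_mul_of_one_le_left (by positivity) (Real.one_le_rpow hq1 (by norm_num))).trans hlow
      rw [div_le_iff₀ hq0]
      have h5 : (P : ℝ) * R ≤ q * mainBound q P R := by
        conv_lhs => rw [hsplitV]
        gcongr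
      linarith
    have hlogq : 1 + Real.log q ≤ G := by
      have h1 := Real.log_le_log (by positivity) hlarge.le
      rw [Real.log_rpow hq0] at h1
      rw [hG]; linarith
    have hlq0 : 0 ≤ Real.log q := Real.log_nonneg hq1
    have hG2 : 1 ≤ (D : ℝ) * G ^ 2 := one_le_mul_of_one_le_of_one_le hD1 (one_le_pow₀ hG1)
    calc rootDiscrepancy q P R ≤ _ := hmain
      -- One `G` comes from completion and one from the energies; `18` is `16` plus the `2` from
      -- rounding.
      _ ≤ 2 * mainBound q P R + G * (16 * D * G * mainBound q P R) := by gcongr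
      _ = 2 * 1 * mainBound q P R + 16 * (D * G ^ 2) * mainBound q P R := by ring
      _ ≤ 2 * (D * G ^ 2) * mainBound q P R + 16 * (D * G ^ 2) * mainBound q P R := by gcongr
      _ = lossFactor (P * R) * mainBound q P R := by
          rw [lossFactor, hG]; push_cast; ring

/-! ### Absorbing the loss into the exponent -/

theorem exists_lossFactor_le_rpow {ε : ℝ} (hε : 0 < ε) :
    ∃ C : ℝ, 0 < C ∧ ∀ V : ℕ, 1 ≤ V → lossFactor V ≤ C * (V : ℝ) ^ ε := by
  -- Divisors are counted for `n ≤ V²`, so `ε / 4` becomes `ε / 2`; the squared logarithm uses the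
  -- other half.
  obtain ⟨K, hK1, hK⟩ := exists_card_divisors_le_rpow (ε := ε / 4) (by positivity)
  refine ⟨18 * K * (1 + 8 / ε) ^ 2, by positivity, fun V hV => ?_⟩
  have hV1 : (1 : ℝ) ≤ V := by exact_mod_cast hV
  have hV0 : (0 : ℝ) < V := by linarith
  have hD : (maxCardDivisors V : ℝ) ≤ K * (V : ℝ) ^ (ε / 2) := by
    obtain ⟨n, hn, hsup⟩ := Finset.exists_mem_eq_sup (Finset.Icc 1 (V ^ 2))
      ⟨1, Finset.mem_Icc.2 ⟨le_rfl, Nat.one_le_pow 2 V hV⟩⟩ fun n : ℕ => n.divisors.card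
    rw [Finset.mem_Icc] at hn
    rw [maxCardDivisors, hsup]
    refine (hK n (by omega)).trans ?_
    have h1 : (n : ℝ) ≤ (V : ℝ) ^ (2 : ℝ) := by
      rw [Real.rpow_two]; exact_mod_cast hn.2
    calc K * (n : ℝ) ^ (ε / 4) ≤ K * ((V : ℝ) ^ (2 : ℝ)) ^ (ε / 4) := by gcongr
      _ = _ := by rw [← Real.rpow_mul hV0.le]; congr 2; ring
  have hG : 1 + 2 * Real.log V ≤ (1 + 8 / ε) * (V : ℝ) ^ (ε / 4) := by
    have h1 := Real.log_le_rpow_div hV0.le (ε := ε / 4) (by positivity)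
    have h2 : (1 : ℝ) ≤ (V : ℝ) ^ (ε / 4) := Real.one_le_rpow hV1 (by positivity)
    calc 1 + 2 * Real.log V ≤ (V : ℝ) ^ (ε / 4) + 2 * ((V : ℝ) ^ (ε / 4) / (ε / 4)) := by linarith
      _ = _ := by field_simp; ring
  have hlog : 0 ≤ Real.log V := Real.log_natCast_nonneg V
  have hpow : (V : ℝ) ^ (ε / 2) * ((V : ℝ) ^ (ε / 4)) ^ 2 = (V : ℝ) ^ ε := by
    rw [← Real.rpow_natCast, ← Real.rpow_mul hV0.le, ← Real.rpow_add hV0]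
    congr 1; push_cast; ring
  calc lossFactor V ≤ 18 * (K * (V : ℝ) ^ (ε / 2)) * ((1 + 8 / ε) * (V : ℝ) ^ (ε / 4)) ^ 2 := by
        rw [lossFactor]; gcongr
    _ = 18 * K * (1 + 8 / ε) ^ 2 * ((V : ℝ) ^ (ε / 2) * ((V : ℝ) ^ (ε / 4)) ^ 2) := by ring
    _ = _ := by rw [hpow]

theorem tendsto_log_lossFactor_div_log :
    Tendsto (fun V : ℕ => Real.log (lossFactor V) / Real.log V) atTop (𝓝 0) := by
  rw [Metric.tendsto_atTop']
  intro ε hε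
  obtain ⟨C, hC0, hC⟩ := exists_lossFactor_le_rpow (ε := ε / 2) (by positivity)
  have hlogtop : Tendsto (fun V : ℕ => Real.log V) atTop atTop :=
    Real.tendsto_log_atTop.comp tendsto_natCast_atTop_atTop
  obtain ⟨n, hn⟩ := eventually_atTop.1 (hlogtop.eventually_gt_atTop (2 * Real.log C / ε))
  refine ⟨max n 1, fun V hV => ?_⟩
  have hV1 : 1 < V := lt_of_le_of_lt (le_max_right _ _) hV
  have hV0 : (0 : ℝ) < V := by exact_mod_cast zero_lt_one.trans hV1
  have hlog : 0 < Real.log V := Real.log_pos (by exact_mod_cast hV1)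
  have hge := eighteen_le_lossFactor hV1.le
  have hL0 : 0 ≤ Real.log (lossFactor V) := Real.log_nonneg (by linarith)
  rw [Real.dist_eq, sub_zero, abs_of_nonneg (by positivity), div_lt_iff₀ hlog]
  have h1 := Real.log_le_log (by linarith) (hC V hV1.le)
  rw [Real.log_mul hC0.ne' (Real.rpow_pos_of_pos hV0 _).ne', Real.log_rpow hV0] at h1
  have h2 := hn V ((le_max_left _ _).trans hV.le)
  rw [div_lt_iff₀ hε] at h2
  linarith

theorem mainTheorem5 :
    ∃ η : ℕ → ℝ, Tendsto η atTop (𝓝 0) ∧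
      ∀ q P R : ℕ, q.Prime → 1 ≤ P → P ≤ q → 1 ≤ R → R ≤ q →
        rootDiscrepancy q P R ≤
          (q : ℝ) ^ (1 / 8 : ℝ) * ((P : ℝ) * (R : ℝ)) ^ ((19 / 24 : ℝ) + η (P * R)) *
            ((P : ℝ) ^ (7 / 48 : ℝ) / (q : ℝ) ^ (1 / 16 : ℝ) + 1) *
            ((R : ℝ) ^ (7 / 48 : ℝ) / (q : ℝ) ^ (1 / 16 : ℝ) + 1) := by
  -- Defined so that `V ^ η V = lossFactor V` for `V ≥ 2`.
  refine ⟨fun V => Real.log (lossFactor V) / Real.log V, tendsto_log_lossFactor_div_log, ?_⟩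
  intro q P R hq hP hPq hR hRq
  have : Fact q.Prime := ⟨hq⟩
  have hV1 : 1 ≤ P * R := Nat.mul_pos hP hR
  rcases hV1.lt_or_eq with hV | hV
  · have hV' : (1 : ℝ) < (P : ℝ) * R := by exact_mod_cast hV
    have hlog : Real.log ((P : ℝ) * R) ≠ 0 := (Real.log_pos hV').ne'
    have hpow : ((P : ℝ) * R) ^ (Real.log (lossFactor (P * R)) / Real.log ((P * R : ℕ) : ℝ)) =
        lossFactor (P * R) := by
      rw [Real.rpow_def_of_pos (by linarith), Nat.cast_mul, mul_div_cancel₀ _ hlog,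
        Real.exp_log (by linarith [eighteen_le_lossFactor hV1])]
    refine (rootDiscrepancy_le_lossFactor_mul hP hPq hR hRq).trans (le_of_eq ?_)
    rw [Real.rpow_add (by linarith), hpow, mainBound]
    ring
  -- For `PR = 1` the power is `1` and absorbs nothing, but no prime is at most `1`, so there are no
  -- points.
  · have hP1 : P = 1 := Nat.eq_one_of_mul_eq_one_right hV.symm
    have hempty : primeProductRoots q P R = ∅ := by
      rw [primeProductRoots, Finset.filter_eq_empty_iff]
      rintro ⟨p, r, x⟩ ht ⟨hp, -⟩
      simp only [Finset.mem_product, Finset.mem_range] at ht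
      have := hp.two_le
      omega
    have h0 : rootDiscrepancy q P R ≤ 0 := by
      refine (discrepancy_le_card _).trans ?_
      rw [card_primeProductRootPoints, hempty]; simp
    exact h0.trans (by positivity)
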